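/- Let $l\neq 0$ be real and let four-dimensional anti-de Sitter space be the manifold $\mathbb{R}\times B$, $B\subset\mathbb{R}^3$ the open unit ball, with polar coordinates $t\in\mathbb{R}$, $x\in[0,\pi/2)$, $n\in S^2$ (a point of $B$ being $y=\tan(x/2)\,n$) and with the metric $$\tilde g=\frac{l^2}{\cos^2x}\,g,\qquad g=-dt^2+dx^2+\sin^2x\,\sigma ,$$ where $\sigma$ is the metric of the unit sphere $S^2$; $\tilde g$ is smooth also at the centre $x=0$. A smooth one-form $\xi$ is a conformal Killing one-form of $\tilde g$ if $\tfrac12(\nabla_\alpha\xi_\beta+\nabla_\beta\xi_\alpha)=\lambda\,\tilde g_{\alpha\beta}$ for some function $\lambda$, where $\nabla$ is the Levi-Civita connection of $\tilde g$. A dipole function is a spherical harmonic of degree one on $S^2$, i.e. the restriction to $S^2$ of a linear function on $\mathbb{R}^3$. Let $\epsilon_{AB}$ be the volume form of the spheres of constant $t,x$ with respect to $\sin^2x\,\sigma$, with indices raised by $g$. For dipole functions $G,D,J_0,J_1$ and real constants $a_0,a_1,c$ put $$R=-\tfrac12\sin^2x\;\epsilon_A{}^{B}D_{,B}\,dx^A,\qquad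 P=G\,dx+\sin x\cos x\,dG,\qquad T=c\,dt,$$ $$B_{J_0}=-\sin x\sin t\,dJ_0-J_0\sin t\cos x\,dx+J_0\cos t\sin x\,dt,$$ $$D_{a_1}=a_1\cos t\sin x\,dx-a_1\sin t\cos x\,dt,$$ $$K_t=a_0\sin t\sin x\,dx+a_0(\cos t\cos x-1)\,dt,$$ $$K_{J_1}=(\sin x\cos x-\sin x\cos t)\,dJ_1-J_1(\cos t\cos x-1)\,dx-J_1\sin t\sin x\,dt .$$ Then, for every choice of $G,D,J_0,J_1,a_0,a_1,c$, the one-form $$\frac{l^2}{\cos^2x}\bigl(R+P+T+B_{J_0}+D_{a_1}+K_t+K_{J_1}\bigr),$$ defined for $x\neq 0$, extends to a (smooth) conformal Killing one-form of $\tilde g$ on all of anti-de Sitter space. Conversely, every conformal Killing one-form of $\tilde g$ is of this form for $x\neq0$, with uniquely determined $G,D,J_0,J_1,a_0,a_1,c$. The real vector space of conformal Killing one-forms of $\tilde g$ has dimension $15$. -/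

import Mathlib

open scoped ContDiff

noncomputable section

namespace AdS4

/-! ### Tensor calculus on an open set of `ℝ⁴` -/

/-- Coordinate space `ℝ⁴`; index `0` is the time coordinate. -/
abbrev Coord : Type := Fin 4 → ℝ

/-- The partial derivative `∂_i f` at `p`. -/
def pd (i : Fin 4) (f : Coord → ℝ) (p : Coord) : ℝ :=
  fderiv ℝ f p (Pi.single i 1)

/-- Christoffel symbol `Γ^k_{ij} = ½ g^{km} (∂_i g_{jm} + ∂_j g_{im} - ∂_m g_{ij})` of the metric
with components `g`. -/
def christoffel (g : Coord → Matrix (Fin 4) (Fin 4) ℝ) (p : Coord) (k i j : Fin 4) : ℝ :=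
  1 / 2 * ∑ m, (g p)⁻¹ k m *
    (pd i (fun q => g q j m) p + pd j (fun q => g q i m) p - pd m (fun q => g q i j) p)

/-- The Levi-Civita covariant derivative `∇_i ξ_j = ∂_i ξ_j - Γ^k_{ij} ξ_k` of the one-form with
components `ξ`. -/
def covDeriv (g : Coord → Matrix (Fin 4) (Fin 4) ℝ) (ξ : Coord → Fin 4 → ℝ) (p : Coord)
    (i j : Fin 4) : ℝ :=
  pd i (fun q => ξ q j) p - ∑ k, christoffel g p k i j * ξ p k

/-- `ξ` is a smooth conformal Killing one-form of the metric `g` on the open set `U`: the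
symmetric part of `∇ξ` is a function times the metric. -/
structure IsConformalKilling (U : Set Coord) (g : Coord → Matrix (Fin 4) (Fin 4) ℝ)
    (ξ : Coord → Fin 4 → ℝ) : Prop where
  smooth : ContDiffOn ℝ ∞ ξ U
  conformal : ∃ μ : Coord → ℝ, ∀ p ∈ U, ∀ i j,
    1 / 2 * (covDeriv g ξ p i j + covDeriv g ξ p j i) = μ p * g p i j

/-- The real vector space of conformal Killing one-forms of `g` on the open set `U`, as
one-forms on `U` (values outside `U` do not count). -/
def conformalKillingForms (U : Set Coord) (hU : IsOpen U)
    (g : Coord → Matrix (Fin 4) (Fin 4) ℝ) : Submodule ℝ (U → Fin 4 → ℝ) where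
  carrier := {f | ∃ ξ : Coord → Fin 4 → ℝ, IsConformalKilling U g ξ ∧ ∀ p : U, ξ p = f p}
  zero_mem' := by
    refine ⟨0, ⟨contDiffOn_const, 0, fun p _ i j => ?_⟩, fun _ => rfl⟩
    simp [covDeriv, pd]
  add_mem' := by
    rintro f₁ f₂ ⟨ξ₁, ⟨h₁, μ₁, e₁⟩, r₁⟩ ⟨ξ₂, ⟨h₂, μ₂, e₂⟩, r₂⟩
    refine ⟨ξ₁ + ξ₂, ⟨h₁.add h₂, μ₁ + μ₂, fun p hp i j => ?_⟩, fun p => ?_⟩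
    · have d₁ : ∀ k, DifferentiableAt ℝ (fun q => ξ₁ q k) p := fun k =>
        differentiableAt_pi.1 ((h₁.contDiffAt (hU.mem_nhds hp)).differentiableAt (by simp)) k
      have d₂ : ∀ k, DifferentiableAt ℝ (fun q => ξ₂ q k) p := fun k =>
        differentiableAt_pi.1 ((h₂.contDiffAt (hU.mem_nhds hp)).differentiableAt (by simp)) k
      have key : ∀ i j, covDeriv g (ξ₁ + ξ₂) p i j = covDeriv g ξ₁ p i j + covDeriv g ξ₂ p i j := by
        intro i j
        have : pd i (fun q => (ξ₁ + ξ₂) q j) p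
            = pd i (fun q => ξ₁ q j) p + pd i (fun q => ξ₂ q j) p := by
          simp only [pd, Pi.add_apply]
          rw [fderiv_fun_add (d₁ j) (d₂ j)]
          rfl
        rw [covDeriv, this]
        simp only [covDeriv, Pi.add_apply, mul_add, Finset.sum_add_distrib]
        ring
      rw [key, key, Pi.add_apply]
      linear_combination e₁ p hp i j + e₂ p hp i j
    · simp [r₁, r₂]
  smul_mem' := by
    rintro a f ⟨ξ, ⟨h, μ, e⟩, r⟩
    refine ⟨a • ξ, ⟨h.const_smul a, a • μ, fun p hp i j => ?_⟩, fun p => ?_⟩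
    · have d : ∀ k, DifferentiableAt ℝ (fun q => ξ q k) p := fun k =>
        differentiableAt_pi.1 ((h.contDiffAt (hU.mem_nhds hp)).differentiableAt (by simp)) k
      have key : ∀ i j, covDeriv g (a • ξ) p i j = a * covDeriv g ξ p i j := by
        intro i j
        have : pd i (fun q => (a • ξ) q j) p = a * pd i (fun q => ξ q j) p := by
          simp only [pd, Pi.smul_apply, smul_eq_mul]
          rw [fderiv_const_mul (d j)]
          rfl
        rw [covDeriv, this]
        simp only [covDeriv, Pi.smul_apply, smul_eq_mul, mul_sub, Finset.mul_sum]
        congr 1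
        exact Finset.sum_congr rfl fun k _ => by ring
      rw [key, key, Pi.smul_apply, smul_eq_mul]
      linear_combination a * e p hp i j
    · simp [r]

/-! ### Anti-de Sitter space

The manifold is `ℝ × B` with `B` the open unit ball of `ℝ³`. Its points are written `(t, y)`, and
the polar coordinates `(t, x, n)`, `0 ≤ x < π / 2`, `n ∈ S²`, are related to them by
`y = tan (x / 2) n`. This chart is global and contains the centre `x = 0`. -/

/-- The unit sphere `S²`. -/
abbrev S2 : Type := Metric.sphere (0 : EuclideanSpace ℝ (Fin 3)) 1

/-- The spatial coordinates `y`. -/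
def space (p : Coord) : EuclideanSpace ℝ (Fin 3) := !₂[p 1, p 2, p 3]

/-- The domain of the global chart. -/
def region : Set Coord := {p | ‖space p‖ < 1}

/-- The time coordinate `t`. -/
def tCoord (p : Coord) : ℝ := p 0

/-- The radial coordinate `x`. -/
def xCoord (p : Coord) : ℝ := 2 * Real.arctan ‖space p‖

open Classical in
/-- The angular coordinate `n = y / |y| ∈ S²` (an arbitrary point of `S²` on the axis `y = 0`,
where polar coordinates are undefined). -/
def angle (p : Coord) : S2 :=
  if h : space p = 0 then ⟨EuclideanSpace.single 0 1, by simp⟩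
  else ⟨‖space p‖⁻¹ • space p, by simp [norm_smul, h]⟩

/-- The metric `g = -dt² + dx² + sin² x σ`, in the chart `(t, y)`. See `confMetric_polar`. -/
def confMetric (p : Coord) : Matrix (Fin 4) (Fin 4) ℝ :=
  Matrix.diagonal fun i => if i = 0 then -1 else 4 / (1 + ‖space p‖ ^ 2) ^ 2

/-- The conformal factor `l² / cos² x`. -/
def confFactor (l : ℝ) (p : Coord) : ℝ := l ^ 2 / Real.cos (xCoord p) ^ 2

/-- The anti-de Sitter metric `(l² / cos² x) (-dt² + dx² + sin² x σ)`. -/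
def adsMetric (l : ℝ) (p : Coord) : Matrix (Fin 4) (Fin 4) ℝ := confFactor l p • confMetric p

/-- The components of `dt`. -/
def dt (p : Coord) (i : Fin 4) : ℝ := pd i tCoord p

/-- The components of `dx`. -/
def dx (p : Coord) (i : Fin 4) : ℝ := pd i xCoord p

/-- The components of `dF`, for a function `F` on `S²`. -/
def dS (F : S2 → ℝ) (p : Coord) (i : Fin 4) : ℝ := pd i (fun q => F (angle q)) p

/-- The vector `∂_i n ∈ ℝ³`. -/
def dn (p : Coord) (i : Fin 4) : Fin 3 → ℝ := fun a => pd i (fun q => (angle q).1 a) p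

/-- The components of `ε`: the volume form `sin² x · vol(σ)` of the spheres of constant `t` and
`x`, with vanishing `dt` and `dx` components. The area form of `S²` at `n` is `det (n, u, v)`. -/
def eps (p : Coord) (i j : Fin 4) : ℝ :=
  Real.sin (xCoord p) ^ 2 * Matrix.det ![(angle p).1.ofLp, dn p i, dn p j]

/-- `ε_i^k = ε_{ij} g^{jk}`. -/
def epsMixed (p : Coord) (i k : Fin 4) : ℝ := ∑ j, eps p i j * (confMetric p)⁻¹ j k

/-- The radius `|y|` as a function of the coordinates. -/
theorem norm_space (p : Coord) : ‖space p‖ = Real.sqrt (p 1 ^ 2 + p 2 ^ 2 + p 3 ^ 2) := by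
  simp [space, EuclideanSpace.norm_eq, Fin.sum_univ_three]

theorem hasFDerivAt_norm_space (p : Coord) (h : space p ≠ 0) :
    HasFDerivAt (fun q : Coord => ‖space q‖)
      (‖space p‖⁻¹ • (p 1 • ContinuousLinearMap.proj (R := ℝ) (φ := fun _ : Fin 4 => ℝ) 1
        + p 2 • ContinuousLinearMap.proj (R := ℝ) (φ := fun _ : Fin 4 => ℝ) 2
        + p 3 • ContinuousLinearMap.proj (R := ℝ) (φ := fun _ : Fin 4 => ℝ) 3)) p := by
  have hr : 0 < ‖space p‖ := norm_pos_iff.2 h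
  have e : ∀ k : Fin 4, HasFDerivAt (fun q : Coord => q k)
      (ContinuousLinearMap.proj (R := ℝ) (φ := fun _ : Fin 4 => ℝ) k) p :=
    fun k => (ContinuousLinearMap.proj (R := ℝ) (φ := fun _ : Fin 4 => ℝ) k).hasFDerivAt
  have hs : p 1 ^ 2 + p 2 ^ 2 + p 3 ^ 2 ≠ 0 := by
    intro h0
    rw [norm_space, h0] at hr
    simp at hr
  have key := (((e 1).pow 2).add ((e 2).pow 2)).add ((e 3).pow 2) |>.sqrt hs
  simp only [norm_space]
  refine key.congr_fderiv ?_
  ext v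
  simp
  field_simp

theorem dx_eq (p : Coord) (h : space p ≠ 0) (i : Fin 4) :
    dx p i = if i = 0 then 0 else 2 / (1 + ‖space p‖ ^ 2) * (p i / ‖space p‖) := by
  have key := ((hasFDerivAt_norm_space p h).arctan).const_mul 2
  have : dx p i = _ := congrArg (fun L : Coord →L[ℝ] ℝ => L (Pi.single i 1)) key.fderiv
  rw [this]
  fin_cases i <;> simp <;> ring

theorem dn_eq (p : Coord) (h : space p ≠ 0) (i : Fin 4) (a : Fin 3) :
    dn p i a = if i = 0 then 0 else
      ((if i = a.succ then 1 else 0) - p i * p a.succ / ‖space p‖ ^ 2) / ‖space p‖ := by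
  have hr : ‖space p‖ ≠ 0 := norm_ne_zero_iff.2 h
  have ev : (fun q => (angle q).1 a) =ᶠ[nhds p] fun q => ‖space q‖⁻¹ * q a.succ := by
    have hc : Continuous space := by
      unfold space
      fun_prop
    filter_upwards [hc.continuousAt.eventually_ne h] with q hq
    simp only [angle, hq, dite_false]
    fin_cases a <;> simp [space]
  have key := ((hasFDerivAt_inv hr).comp p (hasFDerivAt_norm_space p h)).mul
    (ContinuousLinearMap.proj (R := ℝ) (φ := fun _ : Fin 4 => ℝ) a.succ).hasFDerivAt
  have : dn p i a = _ := congrArg (fun L : Coord →L[ℝ] ℝ => L (Pi.single i 1))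
    (ev.fderiv_eq.trans key.fderiv)
  rw [this]
  fin_cases i <;> fin_cases a <;> simp <;> field_simp <;> ring

/-- In polar coordinates `confMetric` is `-dt² + dx² + sin² x σ`. -/
theorem confMetric_polar (p : Coord) (h : space p ≠ 0) (i j : Fin 4) :
    confMetric p i j = -(dt p i * dt p j) + dx p i * dx p j
      + Real.sin (xCoord p) ^ 2 * ∑ a, dn p i a * dn p j a := by
  have hr : ‖space p‖ ≠ 0 := norm_ne_zero_iff.2 h
  have hdt : ∀ i, dt p i = if i = 0 then 1 else 0 := by
    intro i
    have : dt p i = _ := congrArg (fun L : Coord →L[ℝ] ℝ => L (Pi.single i 1))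
      (ContinuousLinearMap.proj (R := ℝ) (φ := fun _ : Fin 4 => ℝ) 0).fderiv
    rw [this]
    fin_cases i <;> simp
  have hsin : Real.sin (xCoord p) = 2 * ‖space p‖ / (1 + ‖space p‖ ^ 2) := by
    have h1 : 0 < 1 + ‖space p‖ ^ 2 := by positivity
    rw [xCoord, Real.sin_two_mul, Real.sin_arctan, Real.cos_arctan]
    have := Real.sq_sqrt h1.le
    have h2 : Real.sqrt (1 + ‖space p‖ ^ 2) ≠ 0 := (Real.sqrt_pos.2 h1).ne'
    field_simp
    rw [this]
  have hs : p 1 ^ 2 + p 2 ^ 2 + p 3 ^ 2 = ‖space p‖ ^ 2 := by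
    rw [norm_space, Real.sq_sqrt (by positivity)]
  simp only [dx_eq p h, dn_eq p h, hdt, hsin, Fin.sum_univ_three, confMetric]
  generalize ‖space p‖ = r at *
  have h1 : 1 + r ^ 2 ≠ 0 := by positivity
  fin_cases i <;> fin_cases j <;> simp [Matrix.diagonal] <;> field_simp <;> grind

theorem isOpen_region : IsOpen region := by
  have : Continuous fun p : Coord => ‖space p‖ := by
    unfold space
    fun_prop
  exact isOpen_lt this continuous_const

/-! ### Dipole functions and the list of one-forms -/

/-- The dipole functions on `S²`, i.e. the spherical harmonics of degree one: restrictions of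
linear functions on `ℝ³`. -/
def dipole : Submodule ℝ (S2 → ℝ) where
  carrier := {F | ∃ v : EuclideanSpace ℝ (Fin 3), ∀ n : S2, F n = inner ℝ v n.1}
  zero_mem' := ⟨0, fun n => by simp⟩
  add_mem' := by
    rintro F₁ F₂ ⟨v₁, h₁⟩ ⟨v₂, h₂⟩
    exact ⟨v₁ + v₂, fun n => by simp [h₁, h₂, inner_add_left]⟩
  smul_mem' := by
    rintro a F ⟨v, h⟩
    exact ⟨a • v, fun n => by simp [h, inner_smul_left]⟩

/-- Rotations: `-½ sin² x ε_A^B D_{,B} dx^A`. -/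
def formR (D : S2 → ℝ) (p : Coord) (i : Fin 4) : ℝ :=
  -(1 / 2) * Real.sin (xCoord p) ^ 2 * ∑ k, epsMixed p i k * dS D p k

/-- Spatial translations: `G dx + sin x cos x dG`. -/
def formP (G : S2 → ℝ) (p : Coord) (i : Fin 4) : ℝ :=
  G (angle p) * dx p i + Real.sin (xCoord p) * Real.cos (xCoord p) * dS G p i

/-- Time translation: `c dt`. -/
def formT (c : ℝ) (p : Coord) (i : Fin 4) : ℝ := c * dt p i

/-- Boosts: `-sin x sin t dJ₀ - J₀ sin t cos x dx + J₀ cos t sin x dt`. -/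
def formB (J₀ : S2 → ℝ) (p : Coord) (i : Fin 4) : ℝ :=
  -(Real.sin (xCoord p) * Real.sin (tCoord p)) * dS J₀ p i
    - J₀ (angle p) * Real.sin (tCoord p) * Real.cos (xCoord p) * dx p i
    + J₀ (angle p) * Real.cos (tCoord p) * Real.sin (xCoord p) * dt p i

/-- Dilation: `a₁ cos t sin x dx - a₁ sin t cos x dt`. -/
def formD (a₁ : ℝ) (p : Coord) (i : Fin 4) : ℝ :=
  a₁ * Real.cos (tCoord p) * Real.sin (xCoord p) * dx p i
    - a₁ * Real.sin (tCoord p) * Real.cos (xCoord p) * dt p i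

/-- Time acceleration: `a₀ sin t sin x dx + a₀ (cos t cos x - 1) dt`. -/
def formKt (a₀ : ℝ) (p : Coord) (i : Fin 4) : ℝ :=
  a₀ * Real.sin (tCoord p) * Real.sin (xCoord p) * dx p i
    + a₀ * (Real.cos (tCoord p) * Real.cos (xCoord p) - 1) * dt p i

/-- Space accelerations:
`(sin x cos x - sin x cos t) dJ₁ - J₁ (cos t cos x - 1) dx - J₁ sin t sin x dt`. -/
def formKJ (J₁ : S2 → ℝ) (p : Coord) (i : Fin 4) : ℝ :=
  (Real.sin (xCoord p) * Real.cos (xCoord p) - Real.sin (xCoord p) * Real.cos (tCoord p))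
      * dS J₁ p i
    - J₁ (angle p) * (Real.cos (tCoord p) * Real.cos (xCoord p) - 1) * dx p i
    - J₁ (angle p) * Real.sin (tCoord p) * Real.sin (xCoord p) * dt p i

/-- The parameters: dipole functions `G, D, J₀, J₁` and constants `a₀, a₁, c`. -/
structure Data where
  G : dipole
  D : dipole
  J₀ : dipole
  J₁ : dipole
  a₀ : ℝ
  a₁ : ℝ
  c : ℝ

/-- The sum `R + P + T + B + D + K_t + K_J` of the listed one-forms. -/
def Data.form (d : Data) (p : Coord) (i : Fin 4) : ℝ :=
  formR d.D.1 p i + formP d.G.1 p i + formT d.c p i + formB d.J₀.1 p i + formD d.a₁ p i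
    + formKt d.a₀ p i + formKJ d.J₁.1 p i

/-- The one-form `ξ` is given on anti-de Sitter space by the listed form with parameters `d`
multiplied by the conformal factor, wherever the polar coordinates `(t, x, n)` are defined. -/
def IsGivenBy (l : ℝ) (d : Data) (ξ : Coord → Fin 4 → ℝ) : Prop :=
  ∀ p ∈ region, space p ≠ 0 → ∀ i, ξ p i = confFactor l p * d.form p i

end AdS4

end

/-!
Write a one-form as `ξ_i = D_i V^i`, where `diag D` is the anti-de Sitter metric in the global chart
`(t, y)`. For a diagonal metric the symmetrised covariant derivative of `ξ` is a Lie derivative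
along `V` (`covDeriv_add_covDeriv_of_diagonal`), and the conformal factor only changes the
multiplier. So `ξ` is a conformal Killing one-form exactly when `V` satisfies the conformal Killing
equation of `-dt² + φ² |dy|²`, `φ = 2 / (1 + |y|²)`, which is the first-order system `IsCKV`.

This system can be solved by hand. For fixed `t` the spatial part of `V` is a conformal Killing
field of Euclidean `ℝ³`. In dimension three its expansion `σ = ∂_a V^a` has vanishing second
derivatives (`IsCKV.pd_pd_expan`), and integrating twice shows that
`V^a = b_a + ∑ c, w_ca y_c + s y_a + 2 (k · y) y_a - k_a |y|²` with coefficients that depend on `t`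
(`IsCKV.space_eq`). The remaining equations prescribe the gradient of `V^t`. That it is
closed means that `w` and `b + k` are constant (`IsCKV.time_eqs`) and that `s` and `k - b` solve
`f'' = -f` (`IsCKV.pd_time_time_expan`, `IsCKV.diff_axis`). This leaves `2` constants for `s`, `3`
for `w`, `3` for `b + k`, `6` for `k - b`, and one additive constant for `V^t`: fifteen in all, and
every solution is one of the fields `ckv` (`IsCKV.exists_eq_ckv`), which do solve the system
(`isCKV_ckv`).

It remains to recognise `ckv` as the listed one-forms written in the chart `y = tan (x / 2) n`
(`Params.form_toData`). In particular these extend smoothly to `y = 0`. The values of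
`ckv` at a few points with `|y| = 1 / 2` determine its parameters (`Params.eq_of_field_eq`), so
the map from parameters to conformal Killing one-forms is a linear isomorphism from `ℝ¹⁵`.
-/

open scoped ContDiff

namespace AdS4

/-! ### Partial derivatives on an open set -/

theorem pd_add {f g : Coord → ℝ} {p : Coord} (hf : DifferentiableAt ℝ f p)
    (hg : DifferentiableAt ℝ g p) (i : Fin 4) :
    pd i (fun q => f q + g q) p = pd i f p + pd i g p := by
  simp only [pd, fderiv_fun_add hf hg]; rfl

theorem pd_sub {f g : Coord → ℝ} {p : Coord} (hf : DifferentiableAt ℝ f p)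
    (hg : DifferentiableAt ℝ g p) (i : Fin 4) :
    pd i (fun q => f q - g q) p = pd i f p - pd i g p := by
  simp only [pd, fderiv_fun_sub hf hg]; rfl

theorem pd_neg (f : Coord → ℝ) (p : Coord) (i : Fin 4) :
    pd i (fun q => -f q) p = -pd i f p := by
  simp only [pd, fderiv_fun_neg]; rfl

theorem pd_mul {f g : Coord → ℝ} {p : Coord} (hf : DifferentiableAt ℝ f p)
    (hg : DifferentiableAt ℝ g p) (i : Fin 4) :
    pd i (fun q => f q * g q) p = f p * pd i g p + g p * pd i f p := by
  simp only [pd, fderiv_fun_mul hf hg]; rfl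

theorem pd_pow_two {f : Coord → ℝ} {p : Coord} (hf : DifferentiableAt ℝ f p) (i : Fin 4) :
    pd i (fun q => f q ^ 2) p = 2 * f p * pd i f p := by
  simp only [pow_two, pd_mul hf hf]; ring

theorem pd_const (c : ℝ) (p : Coord) (i : Fin 4) : pd i (fun _ => c) p = 0 := by
  simp [pd]

theorem pd_coord (j : Fin 4) (p : Coord) (i : Fin 4) :
    pd i (fun q => q j) p = if i = j then 1 else 0 := by
  have : pd i (fun q => q j) p = _ := congrArg (fun L : Coord →L[ℝ] ℝ => L (Pi.single i 1))
    (ContinuousLinearMap.proj (R := ℝ) (φ := fun _ : Fin 4 => ℝ) j).hasFDerivAt.fderiv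
  rw [this]
  simp [Pi.single_apply, eq_comm]

theorem pd_comp {f : Coord → ℝ} {p : Coord} {u : ℝ → ℝ} {u' : ℝ} (hu : HasDerivAt u u' (f p))
    (hf : DifferentiableAt ℝ f p) (i : Fin 4) :
    pd i (fun q => u (f q)) p = u' * pd i f p := by
  have := (hu.comp_hasFDerivAt p hf.hasFDerivAt).fderiv
  exact congrArg (fun L : Coord →L[ℝ] ℝ => L (Pi.single i 1)) this

theorem pd_cos_time (p : Coord) (i : Fin 4) :
    pd i (fun q => Real.cos (q 0)) p = if i = 0 then -Real.sin (p 0) else 0 := by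
  rw [pd_comp (f := fun q => q 0) (Real.hasDerivAt_cos _) (by fun_prop), pd_coord]
  split_ifs <;> simp

theorem pd_sin_time (p : Coord) (i : Fin 4) :
    pd i (fun q => Real.sin (q 0)) p = if i = 0 then Real.cos (p 0) else 0 := by
  rw [pd_comp (f := fun q => q 0) (Real.hasDerivAt_sin _) (by fun_prop), pd_coord]
  split_ifs <;> simp

section Region

variable {U : Set Coord} {f g : Coord → ℝ} {p : Coord}

theorem pd_congr (hU : IsOpen U) (h : ∀ q ∈ U, f q = g q) (hp : p ∈ U) (i : Fin 4) :
    pd i f p = pd i g p := by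
  have : f =ᶠ[nhds p] g := by
    filter_upwards [hU.mem_nhds hp] with q hq using h q hq
  rw [pd, this.fderiv_eq, pd]

theorem differentiableAt_of_contDiffOn (hU : IsOpen U) (hf : ContDiffOn ℝ ∞ f U) (hp : p ∈ U) :
    DifferentiableAt ℝ f p :=
  (hf.contDiffAt (hU.mem_nhds hp)).differentiableAt (by simp)

theorem contDiffOn_pd (hU : IsOpen U) (hf : ContDiffOn ℝ ∞ f U) (i : Fin 4) :
    ContDiffOn ℝ ∞ (pd i f) U :=
  (hf.fderiv_of_isOpen (m := ∞) hU (by simp)).clm_apply contDiffOn_const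

theorem pd_comm (hU : IsOpen U) (hf : ContDiffOn ℝ ∞ f U) (hp : p ∈ U) (i j : Fin 4) :
    pd i (pd j f) p = pd j (pd i f) p := by
  have hd : DifferentiableAt ℝ (fderiv ℝ f) p :=
    ((hf.fderiv_of_isOpen (m := ∞) hU (by simp)).contDiffAt
      (hU.mem_nhds hp)).differentiableAt (by simp)
  have key : ∀ i j, pd i (pd j f) p = fderiv ℝ (fderiv ℝ f) p (Pi.single i 1) (Pi.single j 1) := by
    intro i j
    have := (hd.hasFDerivAt.clm_apply (hasFDerivAt_const (Pi.single j (1 : ℝ)) p)).fderiv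
    exact (congrArg (fun L : Coord →L[ℝ] ℝ => L (Pi.single i 1)) this).trans (by simp)
  have hs : IsSymmSndFDerivAt ℝ f p :=
    (hf.contDiffAt (hU.mem_nhds hp)).isSymmSndFDerivAt
      (by simpa using WithTop.coe_le_coe.2 (le_top : (2 : ℕ∞) ≤ ⊤))
  rw [key, key]
  exact hs _ _

theorem fderiv_eq_sum_pd (v : Coord) : fderiv ℝ f p v = ∑ i, v i * pd i f p := by
  conv_lhs => rw [← Finset.univ_sum_single v]
  rw [map_sum]
  refine Finset.sum_congr rfl fun i _ => ?_
  rw [pd, ← smul_eq_mul, ← map_smul, ← Pi.single_smul, smul_eq_mul, mul_one]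

/-! ### The domain of the chart -/

/-- `1 + |y|²`, written in coordinates. -/
def rho (p : Coord) : ℝ := 1 + (p 1 ^ 2 + p 2 ^ 2 + p 3 ^ 2)

/-- The point `(t, 0)` of the centre line `y = 0`. -/
def axis (t : ℝ) : Coord := Pi.single 0 t

theorem norm_space_sq (p : Coord) : ‖space p‖ ^ 2 = p 1 ^ 2 + p 2 ^ 2 + p 3 ^ 2 := by
  rw [norm_space, Real.sq_sqrt (by positivity)]

theorem mem_region_iff : p ∈ region ↔ p 1 ^ 2 + p 2 ^ 2 + p 3 ^ 2 < 1 := by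
  rw [← norm_space_sq, sq_lt_one_iff₀ (norm_nonneg _)]
  rfl

theorem rho_pos (p : Coord) : 0 < rho p := by unfold rho; positivity

theorem rho_ne_zero (p : Coord) : rho p ≠ 0 := (rho_pos p).ne'

theorem contDiff_rho : ContDiff ℝ ∞ rho := by unfold rho; fun_prop

@[fun_prop]
theorem differentiable_rho : Differentiable ℝ rho := contDiff_rho.differentiable (by simp)

theorem pd_rho (p : Coord) (i : Fin 4) : pd i rho p = if i = 0 then 0 else 2 * p i := by
  unfold rho
  simp (disch := fun_prop) only [pd_add, pd_pow_two, pd_const, pd_coord]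
  fin_cases i <;> simp

theorem axis_mem_region (t : ℝ) : axis t ∈ region := by simp [mem_region_iff, axis]

@[simp] theorem axis_zero (t : ℝ) : axis t 0 = t := by simp [axis]

@[simp] theorem axis_of_ne {a : Fin 4} (ha : a ≠ 0) (t : ℝ) : axis t a = 0 := by
  simp [axis, ha]

@[simp] theorem rho_axis (t : ℝ) : rho (axis t) = 1 := by simp [rho]

theorem convex_region : Convex ℝ region := by
  have : region = ((WithLp.linearEquiv 2 ℝ (Fin 3 → ℝ)).symm.toLinearMap ∘ₗ
      LinearMap.funLeft ℝ ℝ (Fin.succ : Fin 3 → Fin 4)) ⁻¹' Metric.ball 0 1 := by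
    ext p
    have : (WithLp.toLp 2 (fun a : Fin 3 => p a.succ)) = space p := by
      ext a
      fin_cases a <;> rfl
    simp [region, LinearMap.funLeft, Function.comp_def, this]
  rw [this]
  exact (convex_ball _ _).linear_preimage _

/-- A function on the region is the same at two points if, along the segment that joins them, the
partial derivatives in the directions in which the points differ vanish. -/
theorem eq_of_pd_eq_zero (hf : ContDiffOn ℝ ∞ f region) {q : Coord} (hp : p ∈ region)
    (hq : q ∈ region) (h : ∀ i, p i = q i ∨ ∀ z ∈ region, pd i f z = 0) : f p = f q := by
  let γ : ℝ → Coord := fun s => q + s • (p - q)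
  have hγ : ∀ s ∈ Set.Icc (0 : ℝ) 1, γ s ∈ region := fun s hs =>
    convex_region.add_smul_sub_mem hq hp hs
  have hd : ∀ s ∈ Set.Icc (0 : ℝ) 1, HasDerivAt (fun s => f (γ s)) 0 s := by
    intro s hs
    have h1 : HasDerivAt γ (p - q) s := by
      have := ((hasDerivAt_id s).smul_const (p - q)).const_add q
      rwa [one_smul] at this
    have h2 := (differentiableAt_of_contDiffOn isOpen_region hf
      (hγ s hs)).hasFDerivAt.comp_hasDerivAt s h1
    suffices h3 : fderiv ℝ f (γ s) (p - q) = 0 by rwa [h3] at h2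
    rw [fderiv_eq_sum_pd]
    refine Finset.sum_eq_zero fun i _ => ?_
    rcases h i with h | h
    · simp [h]
    · rw [h _ (hγ s hs), mul_zero]
  have := constant_of_has_deriv_right_zero (f := fun s => f (γ s)) (a := 0) (b := 1)
    (fun s hs => (hd s hs).continuousAt.continuousWithinAt)
    (fun s hs => (hd s ⟨hs.1, hs.2.le⟩).hasDerivWithinAt) 1 (by simp)
  simpa [γ] using this

/-- A function without spatial derivatives depends on `t` only. -/
theorem eq_axis (hf : ContDiffOn ℝ ∞ f region) (h : ∀ a ≠ 0, ∀ z ∈ region, pd a f z = 0)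
    (hp : p ∈ region) : f p = f (axis (p 0)) := by
  refine eq_of_pd_eq_zero hf hp (axis_mem_region _) fun i => ?_
  by_cases hi : i = 0
  · subst hi; simp
  · exact Or.inr (h i hi)

theorem hasDerivAt_add_axis (hf : ContDiffOn ℝ ∞ f region) (y : Coord) {t : ℝ}
    (hy : y + axis t ∈ region) :
    HasDerivAt (fun t => f (y + axis t)) (pd 0 f (y + axis t)) t := by
  have h1 : HasDerivAt axis (Pi.single 0 1) t := by
    rw [hasDerivAt_pi]
    intro i
    by_cases hi : i = 0
    · subst hi; simp only [axis_zero, Pi.single_eq_same]; exact hasDerivAt_id t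
    · simpa [hi] using hasDerivAt_const t (0 : ℝ)
  exact (differentiableAt_of_contDiffOn isOpen_region hf hy).hasFDerivAt.comp_hasDerivAt t
    (h1.const_add y)

theorem hasDerivAt_axis (hf : ContDiffOn ℝ ∞ f region) (t : ℝ) :
    HasDerivAt (fun t => f (axis t)) (pd 0 f (axis t)) t := by
  simpa using hasDerivAt_add_axis hf 0 (by simpa using axis_mem_region t)

end Region

/-! ### The conformal Killing equation for vector fields -/

/-- For a diagonal metric `g = diag D` and `ξ_i = D_i V^i`, the symmetrised covariant derivative of
`ξ` is the Lie derivative of `g` along `V`. -/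
theorem covDeriv_add_covDeriv_of_diagonal {g : Coord → Matrix (Fin 4) (Fin 4) ℝ}
    {D V : Fin 4 → Coord → ℝ} {ξ : Coord → Fin 4 → ℝ} {p : Coord}
    (hg : ∀ q, g q = Matrix.diagonal fun i => D i q) (hD : ∀ i, DifferentiableAt ℝ (D i) p)
    (hV : ∀ i, DifferentiableAt ℝ (V i) p) (h0 : ∀ i, D i p ≠ 0)
    (hξ : ∀ j i, pd i (fun q => ξ q j) p = pd i (fun q => D j q * V j q) p)
    (hξ' : ∀ j, ξ p j = D j p * V j p) (i j : Fin 4) :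
    covDeriv g ξ p i j + covDeriv g ξ p j i = D j p * pd i (V j) p + D i p * pd j (V i) p
      + if i = j then ∑ k, V k p * pd k (D i) p else 0 := by
  have hinv : (g p)⁻¹ = Matrix.diagonal fun i => (D i p)⁻¹ := by
    refine Matrix.inv_eq_right_inv ?_
    rw [hg, Matrix.diagonal_mul_diagonal, ← Matrix.diagonal_one]
    congr 1
    ext i
    exact mul_inv_cancel₀ (h0 i)
  have hpd : ∀ i j m, pd m (fun q => g q i j) p = if i = j then pd m (D i) p else 0 := by
    intro i j m
    simp only [hg, Matrix.diagonal_apply]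
    split_ifs
    · rfl
    · exact pd_const 0 p m
  have hΓ : ∀ i j k, christoffel g p k i j * ξ p k = 1 / 2 * V k p *
      ((if j = k then pd i (D j) p else 0) + (if i = k then pd j (D i) p else 0)
        - if i = j then pd k (D i) p else 0) := by
    intro i j k
    have := h0 k
    rw [christoffel, hinv, hξ']
    simp only [hpd, Matrix.diagonal_apply, ite_mul, zero_mul, Finset.sum_ite_eq, Finset.mem_univ,
      if_true]
    field_simp
  have hsum : ∀ i j, ∑ k, christoffel g p k i j * ξ p k = 1 / 2 * (V j p * pd i (D j) p
      + V i p * pd j (D i) p - if i = j then ∑ k, V k p * pd k (D i) p else 0) := by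
    intro i j
    simp only [hΓ, mul_add, mul_sub, mul_ite, mul_zero, Finset.sum_add_distrib,
      Finset.sum_sub_distrib, Finset.sum_ite_eq, Finset.mem_univ, if_true]
    split_ifs
    · rw [Finset.mul_sum]
      simp only [mul_assoc]
    · simp [mul_assoc]
  rw [covDeriv, covDeriv, hsum, hsum, hξ, hξ, pd_mul (hD _) (hV _), pd_mul (hD _) (hV _)]
  by_cases h : i = j
  · subst h
    simp only [if_true]
    ring
  · simp only [h, Ne.symm h, if_false]
    ring

/-- The conformal factor `l² / cos² x` in the global chart, where `cos x = (1 - |y|²) / (1 + |y|²)`.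
-/
noncomputable def factor (l : ℝ) (p : Coord) : ℝ := l ^ 2 * rho p ^ 2 * ((2 - rho p)⁻¹) ^ 2

/-- `1 / (1 + |y|²)`. -/
noncomputable def invRho (p : Coord) : ℝ := (rho p)⁻¹

/-- The diagonal entries `-1, φ², φ², φ²` of `confMetric`, where `φ = 2 / (1 + |y|²)`. -/
noncomputable def coef (i : Fin 4) (p : Coord) : ℝ := if i = 0 then -1 else 4 * invRho p ^ 2

theorem rho_eq (p : Coord) : rho p = 1 + ‖space p‖ ^ 2 := by rw [norm_space_sq]; rfl

theorem cos_xCoord (p : Coord) : Real.cos (xCoord p) = (2 - rho p) / rho p := by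
  have h := rho_pos p
  rw [rho_eq] at h ⊢
  rw [xCoord, Real.cos_two_mul, Real.cos_arctan, div_pow, Real.sq_sqrt h.le]
  field_simp

theorem sin_xCoord (p : Coord) : Real.sin (xCoord p) = 2 * ‖space p‖ / rho p := by
  have h := rho_pos p
  rw [rho_eq] at h ⊢
  rw [xCoord, Real.sin_two_mul, Real.sin_arctan, Real.cos_arctan]
  have h1 := Real.sq_sqrt h.le
  have h2 : Real.sqrt (1 + ‖space p‖ ^ 2) ≠ 0 := (Real.sqrt_pos.2 h).ne'
  field_simp
  rw [h1]

theorem confFactor_eq (l : ℝ) (p : Coord) : confFactor l p = factor l p := by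
  rw [confFactor, factor, cos_xCoord, div_pow, div_div_eq_mul_div, div_eq_mul_inv, inv_pow]

theorem adsMetric_eq (l : ℝ) (p : Coord) :
    adsMetric l p = Matrix.diagonal fun i => factor l p * coef i p := by
  rw [adsMetric, confFactor_eq, confMetric, ← Matrix.diagonal_smul]
  congr 1
  ext i
  simp only [Pi.smul_apply, smul_eq_mul, coef, invRho, rho_eq, div_eq_mul_inv, inv_pow]

theorem two_sub_rho_pos {p : Coord} (hp : p ∈ region) : 0 < 2 - rho p := by
  rw [mem_region_iff] at hp
  unfold rho
  linarith

theorem factor_pos {l : ℝ} (hl : l ≠ 0) {p : Coord} (hp : p ∈ region) : 0 < factor l p := by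
  have h1 := rho_pos p
  have h2 := two_sub_rho_pos hp
  unfold factor
  positivity

theorem coef_ne_zero (i : Fin 4) (p : Coord) : coef i p ≠ 0 := by
  have := rho_ne_zero p
  unfold coef
  split_ifs <;> simp [invRho, this]

theorem contDiffOn_factor (l : ℝ) : ContDiffOn ℝ ∞ (factor l) region := by
  unfold factor
  have h : ContDiffOn ℝ ∞ (fun p => (2 - rho p)⁻¹) region :=
    (contDiff_const.sub contDiff_rho).contDiffOn.inv fun p hp => (two_sub_rho_pos hp).ne'
  exact (contDiff_const.mul (contDiff_rho.pow 2)).contDiffOn.mul (h.pow 2)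

theorem contDiff_invRho : ContDiff ℝ ∞ invRho :=
  contDiff_rho.inv rho_ne_zero

@[fun_prop]
theorem differentiable_invRho : Differentiable ℝ invRho :=
  contDiff_invRho.differentiable (by simp)

theorem pd_invRho (p : Coord) (i : Fin 4) :
    pd i invRho p = if i = 0 then 0 else -(2 * p i) * invRho p ^ 2 := by
  unfold invRho
  rw [pd_comp (hasDerivAt_inv (rho_ne_zero p)) (by fun_prop), pd_rho]
  split_ifs
  · simp
  · rw [inv_pow]
    ring

theorem contDiff_coef (i : Fin 4) : ContDiff ℝ ∞ (coef i) := by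
  unfold coef
  split_ifs
  · exact contDiff_const
  · exact contDiff_const.mul (contDiff_invRho.pow 2)

theorem pd_coef (i : Fin 4) (p : Coord) (k : Fin 4) : pd k (coef i) p =
    if i = 0 ∨ k = 0 then 0 else -(16 * p k) * invRho p ^ 3 := by
  unfold coef
  by_cases hi : i = 0
  · simp only [hi, if_true, true_or]
    exact pd_const _ _ _
  · simp (disch := fun_prop) only [hi, if_false, false_or, pd_mul, pd_pow_two, pd_invRho, pd_const]
    split_ifs
    · simp
    · ring

/-- The components `V^i` satisfy the conformal Killing equation of `-dt² + φ² |dy|²`,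
`φ = 2 / (1 + |y|²)`, on the region: the equations for the pairs of indices `(a, b)`, `(a, a)`,
`(a, 0)` and `(0, 0)`, with `a ≠ b` spatial. -/
structure IsCKV (V : Fin 4 → Coord → ℝ) : Prop where
  smooth : ∀ i, ContDiffOn ℝ ∞ (V i) region
  shear : ∀ p ∈ region, ∀ a b, a ≠ 0 → b ≠ 0 → a ≠ b → pd a (V b) p = -pd b (V a) p
  expansion : ∀ p ∈ region, ∀ a b, a ≠ 0 → b ≠ 0 → pd a (V a) p = pd b (V b) p
  mixed : ∀ p ∈ region, ∀ a, a ≠ 0 → rho p ^ 2 * pd a (V 0) p = 4 * pd 0 (V a) p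
  time : ∀ p ∈ region, rho p * pd 0 (V 0) p =
    rho p * pd 1 (V 1) p - 2 * (p 1 * V 1 p + p 2 * V 2 p + p 3 * V 3 p)

/-- The one-form obtained from the components `V^i` by lowering the index with `adsMetric l`. -/
noncomputable def lower (l : ℝ) (V : Fin 4 → Coord → ℝ) (p : Coord) (i : Fin 4) : ℝ :=
  factor l p * coef i p * V i p

theorem covDeriv_lower {l : ℝ} (hl : l ≠ 0) {V : Fin 4 → Coord → ℝ}
    (hV : ∀ i, ContDiffOn ℝ ∞ (V i) region) {ξ : Coord → Fin 4 → ℝ}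
    (hξ : ∀ p ∈ region, ∀ i, ξ p i = lower l V p i) {p : Coord} (hp : p ∈ region) (i j : Fin 4) :
    covDeriv (adsMetric l) ξ p i j + covDeriv (adsMetric l) ξ p j i =
      factor l p * (coef j p * pd i (V j) p + coef i p * pd j (V i) p)
      + if i = j then factor l p * (∑ k, V k p * pd k (coef i) p)
        + coef i p * ∑ k, V k p * pd k (factor l) p else 0 := by
  have dN := differentiableAt_of_contDiffOn isOpen_region (contDiffOn_factor l) hp
  have dc : ∀ i, DifferentiableAt ℝ (coef i) p := fun i =>
    (contDiff_coef i).differentiable (by simp) p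
  rw [covDeriv_add_covDeriv_of_diagonal (D := fun i q => factor l q * coef i q) (V := V)
    (adsMetric_eq l) (fun i => dN.mul (dc i))
    (fun i => differentiableAt_of_contDiffOn isOpen_region (hV i) hp)
    (fun i => mul_ne_zero (factor_pos hl hp).ne' (coef_ne_zero i p))
    (fun j i => pd_congr isOpen_region (fun q hq => hξ q hq j) hp i) (fun j => hξ p hp j)]
  simp only [pd_mul dN (dc _), mul_add, Finset.sum_add_distrib, Finset.mul_sum]
  congr 1
  · ring
  · split_ifs
    · congr 1 <;> exact Finset.sum_congr rfl fun k _ => by ring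
    · rfl

theorem isConformalKilling_of_isCKV {l : ℝ} (hl : l ≠ 0) {V : Fin 4 → Coord → ℝ} (hV : IsCKV V) :
    IsConformalKilling region (adsMetric l) (lower l V) := by
  -- The multiplier is read off from the `(t, t)` component.
  refine ⟨?_, fun p => pd 0 (V 0) p + (∑ k, V k p * pd k (factor l) p) / (2 * factor l p), ?_⟩
  · exact contDiffOn_pi.2 fun i =>
      ((contDiffOn_factor l).mul (contDiff_coef i).contDiffOn).mul (hV.smooth i)
  · intro p hp i j
    have hN := (factor_pos hl hp).ne'
    have hr := rho_ne_zero p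
    rw [covDeriv_lower hl hV.smooth (fun _ _ _ => rfl) hp, adsMetric_eq, Matrix.diagonal_apply]
    by_cases hij : i = j
    · subst hij
      simp only [if_true]
      by_cases hi : i = 0
      · subst hi
        simp only [pd_coef, coef, if_true, true_or, mul_zero, Finset.sum_const_zero]
        field_simp
        ring
      · have ht := hV.time p hp
        rw [hV.expansion p hp 1 i (by decide) hi] at ht
        generalize hS : ∑ k, V k p * pd k (factor l) p = S
        simp only [pd_coef, coef, invRho, hi, if_false, false_or, Fin.sum_univ_four, mul_ite,
          mul_zero, if_true, Fin.reduceEq]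
        field_simp
        linear_combination (-8 * factor l p) * ht
    · simp only [hij, if_false, mul_zero, add_zero]
      by_cases hi : i = 0
      · subst hi
        have := hV.mixed p hp j (Ne.symm hij)
        simp only [coef, invRho, Ne.symm hij, if_true, if_false]
        field_simp
        linear_combination (-factor l p) * this
      · by_cases hj : j = 0
        · subst hj
          have := hV.mixed p hp i hi
          simp only [coef, invRho, hi, if_true, if_false]
          field_simp
          linear_combination (-factor l p) * this
        · rw [hV.shear p hp i j hi hj hij]
          simp only [coef, invRho, hi, hj, if_false]
          ring

theorem isCKV_of_isConformalKilling {l : ℝ} (hl : l ≠ 0) {V : Fin 4 → Coord → ℝ}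
    {ξ : Coord → Fin 4 → ℝ} (hV : ∀ i, ContDiffOn ℝ ∞ (V i) region)
    (h : IsConformalKilling region (adsMetric l) ξ)
    (hξ : ∀ p ∈ region, ∀ i, ξ p i = lower l V p i) : IsCKV V := by
  obtain ⟨-, μ, hμ⟩ := h
  -- Equation `(i, j)`, with the Lie derivative of the conformal factor moved into the multiplier.
  have key : ∀ p ∈ region, ∃ m, ∀ i j, coef j p * pd i (V j) p + coef i p * pd j (V i) p
      + (if i = j then ∑ k, V k p * pd k (coef i) p else 0) =
      if i = j then m * coef i p else 0 := by
    intro p hp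
    refine ⟨2 * μ p - (∑ k, V k p * pd k (factor l) p) / factor l p, fun i j => ?_⟩
    have hN := (factor_pos hl hp).ne'
    have e := hμ p hp i j
    rw [covDeriv_lower hl hV hξ hp, adsMetric_eq, Matrix.diagonal_apply] at e
    refine mul_left_cancel₀ hN ?_
    generalize ∑ k, V k p * pd k (factor l) p = S at *
    split_ifs at e ⊢
    · field_simp
      linear_combination 2 * e
    · linear_combination 2 * e
  have diag : ∀ p ∈ region, ∃ m, (2 * pd 0 (V 0) p = m) ∧ ∀ a, a ≠ 0 →
      2 * (rho p * pd a (V a) p) - 4 * (p 1 * V 1 p + p 2 * V 2 p + p 3 * V 3 p) = rho p * m := by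
    intro p hp
    obtain ⟨m, hm⟩ := key p hp
    have hr := rho_ne_zero p
    refine ⟨m, ?_, fun a ha => ?_⟩
    · have := hm 0 0
      simp only [coef, pd_coef, if_true, true_or, mul_zero, Finset.sum_const_zero] at this
      linarith
    · have := hm a a
      simp only [pd_coef, coef, invRho, ha, if_false, false_or, Fin.sum_univ_four, mul_ite,
        mul_zero, if_true, Fin.reduceEq] at this
      field_simp at this
      linarith
  refine ⟨hV, ?_, ?_, ?_, ?_⟩
  · intro p hp a b ha hb hab
    obtain ⟨m, hm⟩ := key p hp
    have := hm a b
    have hr := rho_ne_zero p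
    simp only [coef, invRho, ha, hb, hab, if_false] at this
    field_simp at this
    linarith
  · intro p hp a b ha hb
    obtain ⟨m, -, hm⟩ := diag p hp
    refine mul_left_cancel₀ (rho_ne_zero p) ?_
    linarith [hm a ha, hm b hb]
  · intro p hp a ha
    obtain ⟨m, hm⟩ := key p hp
    have := hm a 0
    have hr := rho_ne_zero p
    simp only [coef, invRho, ha, if_true, if_false] at this
    field_simp at this
    linarith
  · intro p hp
    obtain ⟨m, h0, hm⟩ := diag p hp
    rw [← h0] at hm
    linarith [hm 1 (by decide)]

/-- Raising the index with `adsMetric l` turns conformal Killing one-forms into solutions of the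
equations for vector fields. -/
theorem exists_isCKV {l : ℝ} (hl : l ≠ 0) {ξ : Coord → Fin 4 → ℝ}
    (h : IsConformalKilling region (adsMetric l) ξ) :
    ∃ V, IsCKV V ∧ ∀ p ∈ region, ∀ i, ξ p i = lower l V p i := by
  have hξ : ∀ p ∈ region, ∀ i,
      ξ p i = lower l (fun i p => (factor l p * coef i p)⁻¹ * ξ p i) p i := fun p hp i =>
    (mul_inv_cancel_left₀ (mul_ne_zero (factor_pos hl hp).ne' (coef_ne_zero i p)) _).symm
  refine ⟨_, isCKV_of_isConformalKilling hl (fun i => ?_) h hξ, hξ⟩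
  exact (((contDiffOn_factor l).mul (contDiff_coef i).contDiffOn).inv fun p hp =>
    mul_ne_zero (factor_pos hl hp).ne' (coef_ne_zero i p)).mul (contDiffOn_pi.1 h.smooth i)

/-! ### The explicit solutions -/

/-- The linear function `v · y`. -/
def dot (v : Fin 3 → ℝ) (p : Coord) : ℝ := v 0 * p 1 + v 1 * p 2 + v 2 * p 3

theorem contDiff_dot (v : Fin 3 → ℝ) : ContDiff ℝ ∞ (dot v) := by unfold dot; fun_prop

@[fun_prop]
theorem differentiable_dot (v : Fin 3 → ℝ) : Differentiable ℝ (dot v) :=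
  (contDiff_dot v).differentiable (by simp)

theorem pd_dot (v : Fin 3 → ℝ) (p : Coord) (i : Fin 4) :
    pd i (dot v) p = (![0, v 0, v 1, v 2] : Fin 4 → ℝ) i := by
  unfold dot
  simp (disch := fun_prop) only [pd_add, pd_mul, pd_const, pd_coord]
  fin_cases i <;> simp

/-- With `M = G + J₁` and `Q = cos t J₁ + sin t J₀`, the coefficient of `y` in the spatial part of
the explicit solutions: `(M + Q) · y + a₁ cos t + a₀ sin t`. -/
noncomputable def radial (G J₀ J₁ : Fin 3 → ℝ) (a₀ a₁ : ℝ) (p : Coord) : ℝ :=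
  dot (G + J₁) p + Real.cos (p 0) * (dot J₁ p + a₁) + Real.sin (p 0) * (dot J₀ p + a₀)

theorem contDiff_radial (G J₀ J₁ : Fin 3 → ℝ) (a₀ a₁ : ℝ) :
    ContDiff ℝ ∞ (radial G J₀ J₁ a₀ a₁) := by
  have := contDiff_dot
  unfold radial
  fun_prop

@[fun_prop]
theorem differentiable_radial (G J₀ J₁ : Fin 3 → ℝ) (a₀ a₁ : ℝ) :
    Differentiable ℝ (radial G J₀ J₁ a₀ a₁) :=
  (contDiff_radial G J₀ J₁ a₀ a₁).differentiable (by simp)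

theorem pd_radial (G J₀ J₁ : Fin 3 → ℝ) (a₀ a₁ : ℝ) (p : Coord) (i : Fin 4) :
    pd i (radial G J₀ J₁ a₀ a₁) p =
      (![-Real.sin (p 0) * (dot J₁ p + a₁) + Real.cos (p 0) * (dot J₀ p + a₀),
        G 0 + J₁ 0 + Real.cos (p 0) * J₁ 0 + Real.sin (p 0) * J₀ 0,
        G 1 + J₁ 1 + Real.cos (p 0) * J₁ 1 + Real.sin (p 0) * J₀ 1,
        G 2 + J₁ 2 + Real.cos (p 0) * J₁ 2 + Real.sin (p 0) * J₀ 2] : Fin 4 → ℝ) i := by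
  unfold radial
  simp (disch := fun_prop) only [pd_add, pd_mul, pd_const, pd_dot, pd_cos_time, pd_sin_time]
  fin_cases i <;> simp
  ring

/-- The vector fields `V^i` whose lowered forms are the listed one-forms, in the global chart. With
`M = G + J₁` and `Q = cos t J₁ + sin t J₀` the spatial part is
`½ ((1 - |y|²) M - D × y - (1 + |y|²) Q) + ((M + Q) · y + a₁ cos t + a₀ sin t) y`. Note that
`2 - rho = 1 - |y|²`, and that lowering the index changes the sign of the time component. -/
noncomputable def ckv (G D J₀ J₁ : Fin 3 → ℝ) (a₀ a₁ c : ℝ) : Fin 4 → Coord → ℝ :=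
  ![fun p => a₀ - c + ((a₁ * Real.sin (p 0) - a₀ * Real.cos (p 0)) * (2 - rho p)
        - 2 * Real.cos (p 0) * dot J₀ p + 2 * Real.sin (p 0) * dot J₁ p) * invRho p,
    fun p => 1 / 2 * ((2 - rho p) * (G 0 + J₁ 0) - (D 1 * p 3 - D 2 * p 2)
        - rho p * (Real.cos (p 0) * J₁ 0 + Real.sin (p 0) * J₀ 0)) + p 1 * radial G J₀ J₁ a₀ a₁ p,
    fun p => 1 / 2 * ((2 - rho p) * (G 1 + J₁ 1) - (D 2 * p 1 - D 0 * p 3)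
        - rho p * (Real.cos (p 0) * J₁ 1 + Real.sin (p 0) * J₀ 1)) + p 2 * radial G J₀ J₁ a₀ a₁ p,
    fun p => 1 / 2 * ((2 - rho p) * (G 2 + J₁ 2) - (D 0 * p 2 - D 1 * p 1)
        - rho p * (Real.cos (p 0) * J₁ 2 + Real.sin (p 0) * J₀ 2)) + p 3 * radial G J₀ J₁ a₀ a₁ p]

theorem isCKV_ckv (G D J₀ J₁ : Fin 3 → ℝ) (a₀ a₁ c : ℝ) : IsCKV (ckv G D J₀ J₁ a₀ a₁ c) := by
  -- The derivatives of the three spatial components have the same form.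
  have hspace : ∀ (p : Coord) (i b : Fin 4) (m j k d e : ℝ) (u v : Fin 4),
      pd i (fun p => 1 / 2 * ((2 - rho p) * m - (d * p u - e * p v)
        - rho p * (Real.cos (p 0) * j + Real.sin (p 0) * k)) + p b * radial G J₀ J₁ a₀ a₁ p) p =
      1 / 2 * (-(m + (Real.cos (p 0) * j + Real.sin (p 0) * k)) * (if i = 0 then 0 else 2 * p i)
        - (if i = u then d else 0) + (if i = v then e else 0)
        - rho p * (if i = 0 then -Real.sin (p 0) * j + Real.cos (p 0) * k else 0))
      + (if i = b then radial G J₀ J₁ a₀ a₁ p else 0) + p b * pd i (radial G J₀ J₁ a₀ a₁) p := by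
    intro p i b m j k d e u v
    simp (disch := fun_prop) only [pd_add, pd_sub, pd_mul, pd_const, pd_coord, pd_rho,
      pd_cos_time, pd_sin_time]
    split_ifs <;> ring
  have htime : ∀ p i, pd i (ckv G D J₀ J₁ a₀ a₁ c 0) p =
      ((a₁ * Real.sin (p 0) - a₀ * Real.cos (p 0)) * (2 - rho p)
        - 2 * Real.cos (p 0) * dot J₀ p + 2 * Real.sin (p 0) * dot J₁ p)
        * (if i = 0 then 0 else -(2 * p i) * invRho p ^ 2)
      + invRho p * (-(a₁ * Real.sin (p 0) - a₀ * Real.cos (p 0)) * (if i = 0 then 0 else 2 * p i)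
        + (if i = 0 then (a₁ * Real.cos (p 0) + a₀ * Real.sin (p 0)) * (2 - rho p)
          + 2 * Real.sin (p 0) * dot J₀ p + 2 * Real.cos (p 0) * dot J₁ p else 0)
        - 2 * Real.cos (p 0) * pd i (dot J₀) p + 2 * Real.sin (p 0) * pd i (dot J₁) p) := by
    intro p i
    simp only [ckv, Matrix.cons_val_zero]
    simp (disch := fun_prop) only [pd_add, pd_sub, pd_mul, pd_const, pd_rho, pd_invRho,
      pd_cos_time, pd_sin_time]
    split_ifs <;> ring
  have hpd : ∀ p i,
      pd i (ckv G D J₀ J₁ a₀ a₁ c 1) p = _ ∧ pd i (ckv G D J₀ J₁ a₀ a₁ c 2) p = _ ∧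
      pd i (ckv G D J₀ J₁ a₀ a₁ c 3) p = _ :=
    fun p i => ⟨hspace p i 1 _ _ _ _ _ 3 2, hspace p i 2 _ _ _ _ _ 1 3, hspace p i 3 _ _ _ _ _ 2 1⟩
  have h1 := fun p i => (hpd p i).1
  have h2 := fun p i => (hpd p i).2.1
  have h3 := fun p i => (hpd p i).2.2
  refine ⟨fun i => ContDiff.contDiffOn ?_, ?_, ?_, ?_, ?_⟩
  · have hrho := contDiff_rho
    have hinv := contDiff_invRho
    have hdot := contDiff_dot
    have hrad := contDiff_radial
    fin_cases i <;> simp [ckv] <;> fun_prop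
  · intro p _ a b ha hb hab
    fin_cases a <;> fin_cases b <;> simp at ha hb hab ⊢ <;> simp [h1, h2, h3, pd_radial] <;> ring
  · intro p _ a b ha hb
    fin_cases a <;> fin_cases b <;> simp at ha hb ⊢ <;> simp [h1, h2, h3, pd_radial] <;> ring
  · intro p _ a ha
    have := rho_ne_zero p
    fin_cases a <;> simp at ha ⊢ <;> simp [h1, h2, h3, htime, pd_radial, pd_dot, invRho] <;>
      field_simp <;> simp only [rho, dot] <;> ring
  · intro p _
    have := rho_ne_zero p
    rw [h1, htime]
    simp [pd_radial, pd_dot, ckv, invRho]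
    field_simp
    simp only [rho, dot, radial, Pi.add_apply]
    ring

/-! ### Dependence on the spatial coordinates -/

section Space

variable {V : Fin 4 → Coord → ℝ} {p : Coord} {a b c : Fin 4}

/-- The common value `∂_a V^a` of the three spatial divergence terms. -/
noncomputable def expan (V : Fin 4 → Coord → ℝ) : Coord → ℝ := pd 1 (V 1)

theorem IsCKV.contDiffOn_pd (hV : IsCKV V) (a b : Fin 4) : ContDiffOn ℝ ∞ (pd a (V b)) region :=
  AdS4.contDiffOn_pd isOpen_region (hV.smooth b) a

theorem IsCKV.contDiffOn_expan (hV : IsCKV V) : ContDiffOn ℝ ∞ (expan V) region :=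
  hV.contDiffOn_pd 1 1

theorem IsCKV.pd_self (hV : IsCKV V) (hp : p ∈ region) (ha : a ≠ 0) :
    pd a (V a) p = expan V p :=
  hV.expansion p hp a 1 ha (by decide)

theorem IsCKV.pd_pd_self (hV : IsCKV V) (hp : p ∈ region) (hb : b ≠ 0) :
    pd a (pd b (V b)) p = pd a (expan V) p :=
  pd_congr isOpen_region (fun _ hq => hV.pd_self hq hb) hp a

theorem IsCKV.pd_shear (hV : IsCKV V) (hp : p ∈ region) (ha : a ≠ 0) (hb : b ≠ 0) (hab : a ≠ b) :
    pd c (pd a (V b)) p = -pd c (pd b (V a)) p := by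
  rw [← pd_neg]
  exact pd_congr isOpen_region (fun q hq => hV.shear q hq a b ha hb hab) hp c

theorem IsCKV.pd_comm (hV : IsCKV V) (hp : p ∈ region) :
    pd a (pd b (V c)) p = pd b (pd a (V c)) p :=
  AdS4.pd_comm isOpen_region (hV.smooth c) hp a b

theorem IsCKV.pd_pd_same (hV : IsCKV V) (hp : p ∈ region) (ha : a ≠ 0) (hb : b ≠ 0) (hab : a ≠ b) :
    pd a (pd a (V b)) p = -pd b (expan V) p := by
  rw [hV.pd_shear hp ha hb hab, hV.pd_comm hp, hV.pd_pd_self hp ha]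

theorem IsCKV.pd_pd_cross (hV : IsCKV V) (hp : p ∈ region) (hb : b ≠ 0) :
    pd b (pd a (V b)) p = pd a (expan V) p := by
  rw [hV.pd_comm hp, hV.pd_pd_self hp hb]

/-- For distinct indices `∂_a ∂_b V^c` is symmetric in `a, b` and antisymmetric in `b, c`, which
forces it to vanish. -/
theorem IsCKV.pd_pd_distinct (hV : IsCKV V) (hp : p ∈ region) (ha : a ≠ 0) (hb : b ≠ 0)
    (hc : c ≠ 0) (hab : a ≠ b) (hac : a ≠ c) (hbc : b ≠ c) : pd a (pd b (V c)) p = 0 := by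
  have h1 := hV.pd_shear (c := a) hp hb hc hbc
  have h2 := hV.pd_shear (c := c) hp ha hb hab
  have h3 := hV.pd_shear (c := b) hp hc ha hac.symm
  rw [hV.pd_comm hp (a := a) (b := c)] at h1
  rw [hV.pd_comm hp (a := c) (b := b)] at h2
  rw [hV.pd_comm hp (a := b) (b := a)] at h3
  linarith

/-- The expansion is an affine function of `y`, because there are three spatial dimensions. -/
theorem IsCKV.pd_pd_expan (hV : IsCKV V) (hp : p ∈ region) (ha : a ≠ 0) (hb : b ≠ 0) :
    pd a (pd b (expan V)) p = 0 := by
  have hcomm : ∀ a b c d, pd a (pd b (pd c (V d))) p = pd b (pd a (pd c (V d))) p :=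
    fun a b c d => AdS4.pd_comm isOpen_region (hV.contDiffOn_pd c d) hp a b
  have hne : ∀ a b : Fin 4, a ≠ 0 → b ≠ 0 → a ≠ b → pd a (pd b (expan V)) p = 0 := by
    intro a b ha hb hab
    obtain ⟨c, hc, hac, hbc⟩ : ∃ c : Fin 4, c ≠ 0 ∧ a ≠ c ∧ b ≠ c := by decide +revert
    have h1 : pd a (pd b (expan V)) p = pd a (pd c (pd b (V c))) p :=
      pd_congr isOpen_region (fun q hq => (hV.pd_pd_cross hq hc).symm) hp a
    have h2 : pd c (pd a (pd b (V c))) p = pd c (fun _ => 0) p :=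
      pd_congr isOpen_region (fun q hq => hV.pd_pd_distinct hq ha hb hc hab hac hbc) hp c
    rw [h1, hcomm, h2, pd_const]
  have hopp : ∀ a b : Fin 4, a ≠ 0 → b ≠ 0 → a ≠ b →
      pd a (pd a (expan V)) p = -pd b (pd b (expan V)) p := by
    intro a b ha hb hab
    have h1 : pd a (pd a (expan V)) p = pd a (pd b (pd a (V b))) p :=
      pd_congr isOpen_region (fun q hq => (hV.pd_pd_cross hq hb).symm) hp a
    have h2 : pd b (pd a (pd a (V b))) p = pd b (fun q => -pd b (expan V) q) p :=
      pd_congr isOpen_region (fun q hq => hV.pd_pd_same hq ha hb hab) hp b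
    rw [h1, hcomm, h2, pd_neg]
  by_cases hab : a = b
  · subst hab
    obtain ⟨u, v, hu, hv, hau, hav, huv⟩ :
        ∃ u v : Fin 4, u ≠ 0 ∧ v ≠ 0 ∧ a ≠ u ∧ a ≠ v ∧ u ≠ v := by decide +revert
    linarith [hopp a u ha hu hau, hopp a v ha hv hav, hopp u v hu hv huv]
  · exact hne a b ha hb hab

theorem IsCKV.contDiffOn_pd_expan (hV : IsCKV V) (a : Fin 4) :
    ContDiffOn ℝ ∞ (pd a (expan V)) region :=
  AdS4.contDiffOn_pd isOpen_region hV.contDiffOn_expan a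

theorem IsCKV.pd_expan_eq (hV : IsCKV V) (hp : p ∈ region) (ha : a ≠ 0) :
    pd a (expan V) p = pd a (expan V) (axis (p 0)) :=
  eq_axis (hV.contDiffOn_pd_expan a) (fun _ hb _ hz => hV.pd_pd_expan hz hb ha) hp

/-- The expansion, as an affine function of `y`. -/
theorem IsCKV.expan_eq (hV : IsCKV V) (hp : p ∈ region) :
    expan V p = expan V (axis (p 0)) + pd 1 (expan V) (axis (p 0)) * p 1
      + pd 2 (expan V) (axis (p 0)) * p 2 + pd 3 (expan V) (axis (p 0)) * p 3 := by
  have hσ := hV.contDiffOn_expan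
  have h1 := hV.contDiffOn_pd_expan 1
  have h2 := hV.contDiffOn_pd_expan 2
  have h3 := hV.contDiffOn_pd_expan 3
  have e := eq_axis (f := fun q => expan V q - pd 1 (expan V) q * q 1 - pd 2 (expan V) q * q 2
    - pd 3 (expan V) q * q 3) (by fun_prop) (fun a ha z hz => ?_) hp
  · simp only [axis_of_ne (show (1 : Fin 4) ≠ 0 by decide),
      axis_of_ne (show (2 : Fin 4) ≠ 0 by decide), axis_of_ne (show (3 : Fin 4) ≠ 0 by decide)] at e
    rw [← hV.pd_expan_eq hp (by decide), ← hV.pd_expan_eq hp (by decide),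
      ← hV.pd_expan_eq hp (by decide)]
    linarith
  · have dσ := differentiableAt_of_contDiffOn isOpen_region hσ hz
    have d1 := differentiableAt_of_contDiffOn isOpen_region h1 hz
    have d2 := differentiableAt_of_contDiffOn isOpen_region h2 hz
    have d3 := differentiableAt_of_contDiffOn isOpen_region h3 hz
    simp (disch := fun_prop) only [pd_sub, pd_mul, pd_coord]
    rw [hV.pd_pd_expan hz ha (by decide), hV.pd_pd_expan hz ha (by decide),
      hV.pd_pd_expan hz ha (by decide)]
    fin_cases a <;> simp at ha ⊢

theorem exists_third (ha : a ≠ 0) (hb : b ≠ 0) (hab : a ≠ b) :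
    ∃ c : Fin 4, c ≠ 0 ∧ a ≠ c ∧ b ≠ c := by
  decide +revert

theorem eq_or_eq_or_eq {d : Fin 4} (hd : d ≠ 0) (ha : a ≠ 0) (hb : b ≠ 0) (hc : c ≠ 0)
    (hab : a ≠ b) (hac : a ≠ c) (hbc : b ≠ c) : d = a ∨ d = b ∨ d = c := by
  decide +revert

/-- The off-diagonal spatial derivatives of `V`, as affine functions of `y`. -/
theorem IsCKV.pd_eq (hV : IsCKV V) (hp : p ∈ region) (ha : a ≠ 0) (hb : b ≠ 0) (hab : a ≠ b) :
    pd a (V b) p = pd a (V b) (axis (p 0)) + pd a (expan V) (axis (p 0)) * p b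
      - pd b (expan V) (axis (p 0)) * p a := by
  have h0 := hV.contDiffOn_pd a b
  have h1 := hV.contDiffOn_pd_expan a
  have h2 := hV.contDiffOn_pd_expan b
  have e := eq_axis (f := fun q => pd a (V b) q - pd a (expan V) q * q b
    + pd b (expan V) q * q a) (by fun_prop) (fun d hd z hz => ?_) hp
  · simp only [axis_of_ne ha, axis_of_ne hb] at e
    rw [← hV.pd_expan_eq hp ha, ← hV.pd_expan_eq hp hb]
    linarith
  · have d0 := differentiableAt_of_contDiffOn isOpen_region h0 hz
    have d1 := differentiableAt_of_contDiffOn isOpen_region h1 hz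
    have d2 := differentiableAt_of_contDiffOn isOpen_region h2 hz
    simp (disch := fun_prop) only [pd_sub, pd_add, pd_mul, pd_coord]
    rw [hV.pd_pd_expan hz hd ha, hV.pd_pd_expan hz hd hb]
    obtain ⟨c, hc, hac, hbc⟩ := exists_third ha hb hab
    rcases eq_or_eq_or_eq hd ha hb hc hab hac hbc with rfl | rfl | rfl
    · rw [hV.pd_pd_same hz ha hb hab]
      simp [hab]
    · rw [hV.pd_pd_cross hz hb]
      simp [hab.symm]
    · rw [hV.pd_pd_distinct hz hd ha hb hac.symm hbc.symm hab]
      simp [hac.symm, hbc.symm]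

/-- For fixed `t`, the spatial part of `V` is a conformal Killing field of Euclidean `ℝ³`, hence
quadratic in `y`. -/
theorem IsCKV.space_eq (hV : IsCKV V) (hp : p ∈ region) (ha : a ≠ 0) (hb : b ≠ 0) (hc : c ≠ 0)
    (hab : a ≠ b) (hac : a ≠ c) (hbc : b ≠ c) :
    V a p = V a (axis (p 0)) + pd b (V a) (axis (p 0)) * p b + pd c (V a) (axis (p 0)) * p c
      + expan V (axis (p 0)) * p a
      + (pd a (expan V) (axis (p 0)) * p a + pd b (expan V) (axis (p 0)) * p b
        + pd c (expan V) (axis (p 0)) * p c) * p a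
      - 1 / 2 * pd a (expan V) (axis (p 0)) * (p a ^ 2 + p b ^ 2 + p c ^ 2) := by
  have h0 := hV.smooth a
  have h1 := hV.contDiffOn_pd b a
  have h2 := hV.contDiffOn_pd c a
  have h3 := hV.contDiffOn_expan
  have h4 := hV.contDiffOn_pd_expan a
  have h5 := hV.contDiffOn_pd_expan b
  have h6 := hV.contDiffOn_pd_expan c
  -- `V^a` minus the quadratic polynomial, whose coefficients at the centre are expressed through
  -- derivatives at the same point, has no spatial derivatives.
  have e := eq_axis (f := fun q => V a q - pd b (V a) q * q b - pd c (V a) q * q c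
    + pd b (expan V) q * (q a * q b) + pd c (expan V) q * (q a * q c)
    - pd a (expan V) q * (q b ^ 2 + q c ^ 2) - expan V q * q a
    + 1 / 2 * (pd a (expan V) q * (q a ^ 2 + q b ^ 2 + q c ^ 2))) (by fun_prop)
    (fun d hd z hz => ?_) hp
  · simp only [axis_of_ne ha, axis_of_ne hb, axis_of_ne hc] at e
    have hσ : expan V p = expan V (axis (p 0)) + pd a (expan V) (axis (p 0)) * p a
        + pd b (expan V) (axis (p 0)) * p b + pd c (expan V) (axis (p 0)) * p c := by
      rw [hV.expan_eq hp]
      clear * - ha hb hc hab hac hbc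
      fin_cases a <;> fin_cases b <;> fin_cases c <;> simp at ha hb hc hab hac hbc ⊢ <;> ring
    rw [hV.pd_expan_eq hp ha, hV.pd_expan_eq hp hb, hV.pd_expan_eq hp hc,
      hV.pd_eq hp hb ha hab.symm, hV.pd_eq hp hc ha hac.symm, hσ] at e
    linear_combination e
  · have d0 := differentiableAt_of_contDiffOn isOpen_region h0 hz
    have d1 := differentiableAt_of_contDiffOn isOpen_region h1 hz
    have d2 := differentiableAt_of_contDiffOn isOpen_region h2 hz
    have d3 := differentiableAt_of_contDiffOn isOpen_region h3 hz
    have d4 := differentiableAt_of_contDiffOn isOpen_region h4 hz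
    have d5 := differentiableAt_of_contDiffOn isOpen_region h5 hz
    have d6 := differentiableAt_of_contDiffOn isOpen_region h6 hz
    simp (disch := fun_prop) only [pd_sub, pd_add, pd_mul, pd_coord, pd_pow_two, pd_const]
    rw [hV.pd_pd_expan hz hd ha, hV.pd_pd_expan hz hd hb, hV.pd_pd_expan hz hd hc]
    rcases eq_or_eq_or_eq hd ha hb hc hab hac hbc with rfl | rfl | rfl
    · rw [hV.pd_pd_cross hz ha, hV.pd_pd_cross hz ha, hV.pd_self hz ha]
      simp [hab, hac]
      ring
    · rw [hV.pd_pd_same hz hb ha hab.symm, hV.pd_pd_distinct hz hb hc ha hbc hab.symm hac.symm]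
      simp [hab.symm, hbc]
      ring
    · rw [hV.pd_pd_same hz hc ha hac.symm,
        hV.pd_pd_distinct hz hc hb ha hbc.symm hac.symm hab.symm]
      simp [hac.symm, hbc.symm]
      ring

end Space

/-! ### Dependence on time -/

section Time

variable {V : Fin 4 → Coord → ℝ} {p : Coord} {a b c : Fin 4}

/-- Integrability `∂_c ∂_a V^t = ∂_a ∂_c V^t` of the mixed equations. -/
theorem IsCKV.integrability_space (hV : IsCKV V) (hp : p ∈ region) (ha : a ≠ 0) (hc : c ≠ 0)
    (hac : a ≠ c) : rho p * pd 0 (pd c (V a)) p =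
      2 * (p c * pd 0 (V a) p - p a * pd 0 (V c) p) := by
  have key : ∀ a c : Fin 4, a ≠ 0 → c ≠ 0 →
      rho p ^ 2 * pd c (pd a (V 0)) p + 4 * rho p * p c * pd a (V 0) p
        = 4 * pd 0 (pd c (V a)) p := by
    intro a c ha hc
    have h := pd_congr isOpen_region (fun q hq => hV.mixed q hq a ha) hp c
    have d1 := differentiableAt_of_contDiffOn isOpen_region (hV.contDiffOn_pd a 0) hp
    have d2 := differentiableAt_of_contDiffOn isOpen_region (hV.contDiffOn_pd 0 a) hp
    simp (disch := fun_prop) only [pd_mul, pd_pow_two, pd_rho, pd_const, hc, if_false] at h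
    rw [hV.pd_comm hp (a := c) (b := 0)] at h
    linarith
  have h1 := key a c ha hc
  have h2 := key c a hc ha
  rw [hV.pd_comm hp (a := a) (b := c), hV.pd_shear hp ha hc hac] at h2
  have h3 := hV.mixed p hp a ha
  have h4 := hV.mixed p hp c hc
  linear_combination (-rho p / 8) * h1 + (rho p / 8) * h2 + p c / 2 * h3 - p a / 2 * h4

/-- Integrability `∂_a ∂_t V^t = ∂_t ∂_a V^t` of the mixed equations and the time equation. -/
theorem IsCKV.integrability_time (hV : IsCKV V) (hp : p ∈ region) (ha : a ≠ 0) :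
    4 * pd 0 (pd 0 (V a)) p = rho p ^ 2 * pd a (expan V) p
      + 4 * p a * (p 1 * V 1 p + p 2 * V 2 p + p 3 * V 3 p) - 2 * rho p * V a p
      - 2 * rho p * (p 1 * pd a (V 1) p + p 2 * pd a (V 2) p + p 3 * pd a (V 3) p) := by
  have h := pd_congr isOpen_region (fun q hq => hV.time q hq) hp a
  have h' := pd_congr isOpen_region (fun q hq => hV.mixed q hq a ha) hp 0
  have d0 := differentiableAt_of_contDiffOn isOpen_region (hV.contDiffOn_pd 0 0) hp
  have dσ := differentiableAt_of_contDiffOn isOpen_region (hV.contDiffOn_pd 1 1) hp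
  have d1 := differentiableAt_of_contDiffOn isOpen_region (hV.smooth 1) hp
  have d2 := differentiableAt_of_contDiffOn isOpen_region (hV.smooth 2) hp
  have d3 := differentiableAt_of_contDiffOn isOpen_region (hV.smooth 3) hp
  have da := differentiableAt_of_contDiffOn isOpen_region (hV.contDiffOn_pd 0 a) hp
  have da' := differentiableAt_of_contDiffOn isOpen_region (hV.contDiffOn_pd a 0) hp
  simp (disch := fun_prop) only [pd_mul, pd_add, pd_sub, pd_pow_two, pd_rho, pd_const, pd_coord, ha,
    if_false, if_true] at h h'
  rw [hV.pd_comm hp (a := a) (b := 0)] at h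
  have ht := hV.time p hp
  have hsum : V 1 p * (if a = 1 then 1 else 0) + V 2 p * (if a = 2 then 1 else 0)
      + V 3 p * (if a = 3 then 1 else 0) = V a p := by
    clear * - ha
    fin_cases a <;> simp at ha ⊢
  rw [show pd a (pd 1 (V 1)) p = pd a (expan V) p from rfl] at h
  linear_combination rho p * h - h' - 2 * p a * ht - 2 * rho p * hsum

/-- A solution of `f'' = -f`. -/
theorem eq_cos_add_sin {f f' : ℝ → ℝ} (h : ∀ t, HasDerivAt f (f' t) t)
    (h' : ∀ t, HasDerivAt f' (-f t) t) (t : ℝ) :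
    f t = f 0 * Real.cos t + f' 0 * Real.sin t := by
  have h1 : ∀ t, HasDerivAt (fun t => f t * Real.cos t - f' t * Real.sin t) 0 t := fun t =>
    (((h t).mul (Real.hasDerivAt_cos t)).sub ((h' t).mul (Real.hasDerivAt_sin t))).congr_deriv
      (by ring)
  have h2 : ∀ t, HasDerivAt (fun t => f t * Real.sin t + f' t * Real.cos t) 0 t := fun t =>
    (((h t).mul (Real.hasDerivAt_sin t)).add ((h' t).mul (Real.hasDerivAt_cos t))).congr_deriv
      (by ring)
  have e1 := is_const_of_deriv_eq_zero (fun t => (h1 t).differentiableAt)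
    (fun t => (h1 t).deriv) t 0
  have e2 := is_const_of_deriv_eq_zero (fun t => (h2 t).differentiableAt)
    (fun t => (h2 t).deriv) t 0
  simp only [Real.cos_zero, Real.sin_zero] at e1 e2
  linear_combination Real.cos t * e1 + Real.sin t * e2 - f t * Real.sin_sq_add_cos_sq t

/-- The point `(t, y)` with `y` half the `a`-th basis vector. -/
noncomputable def halfPt (a : Fin 4) (t : ℝ) : Coord := Pi.single a (1 / 2) + axis t

theorem halfPt_zero (ha : a ≠ 0) (t : ℝ) : halfPt a t 0 = t := by
  simp [halfPt, ha.symm]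

theorem halfPt_self (ha : a ≠ 0) (t : ℝ) : halfPt a t a = 1 / 2 := by
  simp [halfPt, ha]

theorem halfPt_of_ne (hb : b ≠ 0) (hab : b ≠ a) (t : ℝ) : halfPt a t b = 0 := by
  simp [halfPt, hb, hab]

theorem rho_halfPt (ha : a ≠ 0) (t : ℝ) : rho (halfPt a t) = 5 / 4 := by
  fin_cases a <;> simp [halfPt, rho] at ha ⊢ <;> norm_num

theorem halfPt_mem_region (ha : a ≠ 0) (t : ℝ) : halfPt a t ∈ region := by
  have := rho_halfPt ha t
  rw [mem_region_iff]
  unfold rho at this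
  linarith

theorem hasDerivAt_halfPt {f : Coord → ℝ} (hf : ContDiffOn ℝ ∞ f region) (ha : a ≠ 0) (t : ℝ) :
    HasDerivAt (fun t => f (halfPt a t)) (pd 0 f (halfPt a t)) t :=
  hasDerivAt_add_axis hf _ (halfPt_mem_region ha t)

/-- The zeroth- and first-order parts in `y` of `IsCKV.integrability_space` at the centre: the
rotation coefficients are constant, and so is the coefficient of the translations of `S³`. -/
theorem IsCKV.time_eqs (hV : IsCKV V) (ha : a ≠ 0) (hc : c ≠ 0) (hac : a ≠ c) (t : ℝ) :
    pd 0 (pd c (V a)) (axis t) = 0 ∧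
      2 * pd 0 (V a) (axis t) = -pd 0 (pd a (expan V)) (axis t) := by
  obtain ⟨b, hb, hab, hcb⟩ := exists_third ha hc hac
  have dβ := hasDerivAt_axis (hV.smooth a) t
  have dw := hasDerivAt_axis (hV.contDiffOn_pd c a) t
  have dk := hasDerivAt_axis (hV.contDiffOn_pd_expan a) t
  have h0 := hV.integrability_space (axis_mem_region t) ha hc hac
  rw [rho_axis, axis_of_ne ha, axis_of_ne hc] at h0
  have hw : pd 0 (pd c (V a)) (axis t) = 0 := by linarith
  refine ⟨hw, ?_⟩
  -- The second equation is the first-order part in `y` of the integrability condition.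
  have h1 := hV.integrability_space (halfPt_mem_region hc t) ha hc hac
  rw [rho_halfPt hc, halfPt_self hc, halfPt_of_ne ha hac] at h1
  have e1 : pd 0 (pd c (V a)) (halfPt c t) =
      pd 0 (pd c (V a)) (axis t) - 1 / 2 * pd 0 (pd a (expan V)) (axis t) := by
    refine (hasDerivAt_halfPt (hV.contDiffOn_pd c a) hc t).unique
      ((dw.sub (dk.const_mul (1 / 2))).congr_of_eventuallyEq (.of_forall fun t => ?_))
    have := hV.pd_eq (halfPt_mem_region hc t) hc ha hac.symm
    rw [halfPt_zero hc, halfPt_self hc, halfPt_of_ne ha hac] at this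
    simp only [this, Pi.sub_apply]
    ring
  have e2 : pd 0 (V a) (halfPt c t) = pd 0 (V a) (axis t)
      + 1 / 2 * pd 0 (pd c (V a)) (axis t) - 1 / 8 * pd 0 (pd a (expan V)) (axis t) := by
    refine (hasDerivAt_halfPt (hV.smooth a) hc t).unique
      (((dβ.add (dw.const_mul (1 / 2))).sub (dk.const_mul (1 / 8))).congr_of_eventuallyEq
        (.of_forall fun t => ?_))
    have := hV.space_eq (halfPt_mem_region hc t) ha hc hb hac hab hcb
    rw [halfPt_zero hc, halfPt_self hc, halfPt_of_ne ha hac, halfPt_of_ne hb hcb.symm] at this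
    simp only [this, Pi.sub_apply, Pi.add_apply]
    ring
  rw [e1, e2, hw] at h1
  linarith

theorem IsCKV.pd_time_eq (hV : IsCKV V) (ha : a ≠ 0) (t : ℝ) :
    2 * pd 0 (V a) (axis t) = -pd 0 (pd a (expan V)) (axis t) := by
  obtain ⟨c, hc, hac⟩ := (by decide : ∀ a : Fin 4, ∃ c : Fin 4, c ≠ 0 ∧ a ≠ c) a
  exact (hV.time_eqs ha hc hac t).2

theorem IsCKV.pd_eq_const (hV : IsCKV V) (ha : a ≠ 0) (hc : c ≠ 0) (hac : a ≠ c) (t : ℝ) :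
    pd c (V a) (axis t) = pd c (V a) (axis 0) :=
  is_const_of_deriv_eq_zero
    (fun t => (hasDerivAt_axis (hV.contDiffOn_pd c a) t).differentiableAt)
    (fun t => (hasDerivAt_axis (hV.contDiffOn_pd c a) t).deriv.trans
      (hV.time_eqs ha hc hac t).1) t 0

theorem IsCKV.pd_time_time_eq (hV : IsCKV V) (ha : a ≠ 0) (t : ℝ) :
    4 * pd 0 (pd 0 (V a)) (axis t) = pd a (expan V) (axis t) - 2 * V a (axis t) := by
  have := hV.integrability_time (axis_mem_region t) ha
  simp only [axis_of_ne (show (1 : Fin 4) ≠ 0 by decide), axis_of_ne ha, rho_axis,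
    axis_of_ne (show (2 : Fin 4) ≠ 0 by decide),
    axis_of_ne (show (3 : Fin 4) ≠ 0 by decide)] at this
  linarith

/-- The first-order part in `y` of `IsCKV.integrability_time`, obtained by comparing the values at
`y = 0` and at half the first basis vector. -/
theorem IsCKV.pd_time_time_expan (hV : IsCKV V) (t : ℝ) :
    pd 0 (pd 0 (expan V)) (axis t) = -expan V (axis t) := by
  have ha : (1 : Fin 4) ≠ 0 := by decide
  have hβ := hV.smooth 1
  have hβ' := hV.contDiffOn_pd 0 1
  have hk := hV.contDiffOn_pd_expan 1
  have hk' := AdS4.contDiffOn_pd isOpen_region hk 0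
  have hs := hV.contDiffOn_expan
  have hs' := AdS4.contDiffOn_pd isOpen_region hs 0
  have e0 : ∀ t, V 1 (halfPt 1 t) = V 1 (axis t) + 1 / 2 * expan V (axis t)
      + 1 / 8 * pd 1 (expan V) (axis t) := by
    intro t
    have := hV.space_eq (a := 1) (b := 2) (c := 3) (halfPt_mem_region ha t) ha (by decide)
      (by decide) (by decide) (by decide) (by decide)
    rw [halfPt_zero ha, halfPt_self ha, halfPt_of_ne (by decide) (by decide),
      halfPt_of_ne (by decide) (by decide)] at this
    rw [this]
    ring
  have e1 : ∀ t, pd 0 (V 1) (halfPt 1 t) = pd 0 (V 1) (axis t) + 1 / 2 * pd 0 (expan V) (axis t)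
      + 1 / 8 * pd 0 (pd 1 (expan V)) (axis t) := fun t =>
    (hasDerivAt_halfPt hβ ha t).unique
      ((((hasDerivAt_axis hβ t).add ((hasDerivAt_axis hs t).const_mul (1 / 2))).add
        ((hasDerivAt_axis hk t).const_mul (1 / 8))).congr_of_eventuallyEq (.of_forall e0))
  have e2 : pd 0 (pd 0 (V 1)) (halfPt 1 t) = pd 0 (pd 0 (V 1)) (axis t)
      + 1 / 2 * pd 0 (pd 0 (expan V)) (axis t)
      + 1 / 8 * pd 0 (pd 0 (pd 1 (expan V))) (axis t) :=
    (hasDerivAt_halfPt hβ' ha t).unique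
      ((((hasDerivAt_axis hβ' t).add ((hasDerivAt_axis hs' t).const_mul (1 / 2))).add
        ((hasDerivAt_axis hk' t).const_mul (1 / 8))).congr_of_eventuallyEq (.of_forall e1))
  have e3 : 2 * pd 0 (pd 0 (V 1)) (axis t) = -pd 0 (pd 0 (pd 1 (expan V))) (axis t) :=
    ((hasDerivAt_axis hβ' t).const_mul 2).unique
      ((hasDerivAt_axis hk' t).neg.congr_of_eventuallyEq (.of_forall fun t => hV.pd_time_eq ha t))
  have e4 := hV.pd_time_time_eq ha t
  have e5 := hV.integrability_time (halfPt_mem_region ha t) ha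
  rw [rho_halfPt ha, halfPt_self ha, halfPt_of_ne (by decide) (by decide),
    halfPt_of_ne (by decide) (by decide), e0, e2, hV.pd_self (halfPt_mem_region ha t) ha,
    hV.expan_eq (halfPt_mem_region ha t), hV.pd_expan_eq (halfPt_mem_region ha t) ha,
    halfPt_zero ha, halfPt_self ha, halfPt_of_ne (by decide) (by decide),
    halfPt_of_ne (by decide) (by decide)] at e5
  linarith

/-- The expansion oscillates with unit frequency at the centre. -/
theorem IsCKV.expan_axis (hV : IsCKV V) (t : ℝ) : expan V (axis t) =
    expan V (axis 0) * Real.cos t + pd 0 (expan V) (axis 0) * Real.sin t :=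
  eq_cos_add_sin (hasDerivAt_axis hV.contDiffOn_expan)
    (fun t => (hasDerivAt_axis (AdS4.contDiffOn_pd isOpen_region hV.contDiffOn_expan 0)
      t).congr_deriv (hV.pd_time_time_expan t)) t

/-- At the centre `2 V^a + ∂_a ∂_c V^c` is constant. -/
theorem IsCKV.sum_axis (hV : IsCKV V) (ha : a ≠ 0) (t : ℝ) :
    2 * V a (axis t) + pd a (expan V) (axis t) = 2 * V a (axis 0) + pd a (expan V) (axis 0) := by
  have h : ∀ t, HasDerivAt (fun t => 2 * V a (axis t) + pd a (expan V) (axis t)) 0 t := fun t =>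
    (((hasDerivAt_axis (hV.smooth a) t).const_mul 2).add
      (hasDerivAt_axis (hV.contDiffOn_pd_expan a) t)).congr_deriv (by linarith [hV.pd_time_eq ha t])
  exact is_const_of_deriv_eq_zero (fun t => (h t).differentiableAt) (fun t => (h t).deriv) t 0

/-- At the centre `∂_a ∂_c V^c - 2 V^a` oscillates with unit frequency. -/
theorem IsCKV.diff_axis (hV : IsCKV V) (ha : a ≠ 0) (t : ℝ) :
    pd a (expan V) (axis t) - 2 * V a (axis t) =
      (pd a (expan V) (axis 0) - 2 * V a (axis 0)) * Real.cos t
      + -4 * pd 0 (V a) (axis 0) * Real.sin t := by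
  refine eq_cos_add_sin (f := fun t => pd a (expan V) (axis t) - 2 * V a (axis t))
    (f' := fun t => -4 * pd 0 (V a) (axis t)) (fun t => ?_) (fun t => ?_) t
  · exact ((hasDerivAt_axis (hV.contDiffOn_pd_expan a) t).sub
      ((hasDerivAt_axis (hV.smooth a) t).const_mul 2)).congr_deriv
        (by linarith [hV.pd_time_eq ha t])
  · exact ((hasDerivAt_axis (hV.contDiffOn_pd 0 a) t).const_mul (-4)).congr_deriv
      (by linarith [hV.pd_time_time_eq ha t])

/-- Two solutions with the same spatial part differ by a multiple of `∂_t`. -/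
theorem IsCKV.time_unique {W : Fin 4 → Coord → ℝ} (hV : IsCKV V) (hW : IsCKV W)
    (h : ∀ p ∈ region, ∀ a, a ≠ 0 → V a p = W a p) (hp : p ∈ region) :
    V 0 p = W 0 p + (V 0 (axis 0) - W 0 (axis 0)) := by
  have hs : ContDiffOn ℝ ∞ (fun q => V 0 q - W 0 q) region := (hV.smooth 0).sub (hW.smooth 0)
  have e := eq_of_pd_eq_zero hs hp (axis_mem_region 0) fun i => Or.inr fun z hz => ?_
  · linarith
  · have hr := rho_ne_zero z
    rw [pd_sub (differentiableAt_of_contDiffOn isOpen_region (hV.smooth 0) hz)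
      (differentiableAt_of_contDiffOn isOpen_region (hW.smooth 0) hz)]
    have hpd : ∀ a i, a ≠ 0 → pd i (V a) z = pd i (W a) z := fun a i ha =>
      pd_congr isOpen_region (fun q hq => h q hq a ha) hz i
    by_cases hi : i = 0
    · subst hi
      have h1 := hV.time z hz
      have h2 := hW.time z hz
      rw [h z hz 1 (by decide), h z hz 2 (by decide), h z hz 3 (by decide),
        hpd 1 1 (by decide), ← h2] at h1
      exact sub_eq_zero.2 (mul_left_cancel₀ hr h1)
    · have h1 := hV.mixed z hz i hi
      rw [hpd i 0 hi, ← hW.mixed z hz i hi] at h1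
      exact sub_eq_zero.2 (mul_left_cancel₀ (pow_ne_zero 2 hr) h1)

/-- Every solution is one of the explicit ones. -/
theorem IsCKV.exists_eq_ckv (hV : IsCKV V) : ∃ (G D J₀ J₁ : Fin 3 → ℝ) (a₀ a₁ c : ℝ),
    ∀ p ∈ region, ∀ i, V i p = ckv G D J₀ J₁ a₀ a₁ c i p := by
  -- At the centre `2 V = M - Q` and `∇σ = M + Q` with `M` constant and `Q = cos t J₁ + sin t J₀`.
  let M : Fin 3 → ℝ := fun a => V a.succ (axis 0) + 1 / 2 * pd a.succ (expan V) (axis 0)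
  let J₁ : Fin 3 → ℝ := fun a => 1 / 2 * pd a.succ (expan V) (axis 0) - V a.succ (axis 0)
  let J₀ : Fin 3 → ℝ := fun a => -2 * pd 0 (V a.succ) (axis 0)
  let D : Fin 3 → ℝ := ![2 * pd 3 (V 2) (axis 0), 2 * pd 1 (V 3) (axis 0), 2 * pd 2 (V 1) (axis 0)]
  let a₀ := pd 0 (expan V) (axis 0)
  let a₁ := expan V (axis 0)
  have hspace : ∀ c, ∀ p ∈ region, ∀ a, a ≠ 0 →
      V a p = ckv (M - J₁) D J₀ J₁ a₀ a₁ c a p := by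
    intro c p hp a ha
    have hβ : ∀ a : Fin 3, V a.succ (axis (p 0)) =
        1 / 2 * (M a - (Real.cos (p 0) * J₁ a + Real.sin (p 0) * J₀ a)) := by
      intro a
      have h1 := hV.sum_axis (Fin.succ_ne_zero a) (p 0)
      have h2 := hV.diff_axis (Fin.succ_ne_zero a) (p 0)
      simp only [M, J₁, J₀]
      linarith
    have hk : ∀ a : Fin 3, pd a.succ (expan V) (axis (p 0)) =
        M a + (Real.cos (p 0) * J₁ a + Real.sin (p 0) * J₀ a) := by
      intro a
      have h1 := hV.sum_axis (Fin.succ_ne_zero a) (p 0)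
      have h2 := hV.diff_axis (Fin.succ_ne_zero a) (p 0)
      simp only [M, J₁, J₀]
      linarith
    have hw : ∀ a c : Fin 4, a ≠ 0 → c ≠ 0 → a ≠ c →
        pd c (V a) (axis (p 0)) = pd c (V a) (axis 0) :=
      fun a c ha hc hac => hV.pd_eq_const ha hc hac (p 0)
    have hw' : ∀ a c : Fin 4, a ≠ 0 → c ≠ 0 → a ≠ c →
        pd c (V a) (axis 0) = -pd a (V c) (axis 0) :=
      fun a c ha hc hac => hV.shear _ (axis_mem_region 0) c a hc ha hac.symm
    have hs := hV.expan_axis (p 0)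
    have b0 := hβ 0
    have b1 := hβ 1
    have b2 := hβ 2
    have k0 := hk 0
    have k1 := hk 1
    have k2 := hk 2
    simp only [Fin.succ_zero_eq_one, Fin.succ_one_eq_two,
      show (Fin.succ 2 : Fin 4) = 3 from rfl] at b0 b1 b2 k0 k1 k2
    clear_value M J₀ J₁
    rcases eq_or_eq_or_eq ha (a := 1) (b := 2) (c := 3) (by decide) (by decide) (by decide)
      (by decide) (by decide) (by decide) with rfl | rfl | rfl
    · rw [hV.space_eq (a := 1) (b := 2) (c := 3) hp (by decide) (by decide) (by decide) (by decide)
        (by decide) (by decide), hw 1 2 (by decide) (by decide) (by decide),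
        hw 1 3 (by decide) (by decide) (by decide), hw' 1 3 (by decide) (by decide) (by decide),
        hs, b0, k0, k1, k2]
      simp [ckv, radial, rho, dot, D, a₀, a₁]
      ring
    · rw [hV.space_eq (a := 2) (b := 3) (c := 1) hp (by decide) (by decide) (by decide) (by decide)
        (by decide) (by decide), hw 2 3 (by decide) (by decide) (by decide),
        hw 2 1 (by decide) (by decide) (by decide), hw' 2 1 (by decide) (by decide) (by decide),
        hs, b1, k0, k1, k2]
      simp [ckv, radial, rho, dot, D, a₀, a₁]
      ring
    · rw [hV.space_eq (a := 3) (b := 1) (c := 2) hp (by decide) (by decide) (by decide) (by decide)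
        (by decide) (by decide), hw 3 1 (by decide) (by decide) (by decide),
        hw 3 2 (by decide) (by decide) (by decide), hw' 3 2 (by decide) (by decide) (by decide),
        hs, b2, k0, k1, k2]
      simp [ckv, radial, rho, dot, D, a₀, a₁]
      ring
  refine ⟨M - J₁, D, J₀, J₁, a₀, a₁,
    ckv (M - J₁) D J₀ J₁ a₀ a₁ 0 0 (axis 0) - V 0 (axis 0), fun p hp i => ?_⟩
  by_cases hi : i = 0
  · subst hi
    rw [hV.time_unique (isCKV_ckv _ _ _ _ _ _ 0) (hspace 0) hp]
    simp [ckv]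
    ring
  · exact hspace _ p hp i hi

end Time

/-! ### The listed one-forms in the global chart -/

/-- The dipole function `n ↦ v · n`. -/
noncomputable def dipoleOf (v : Fin 3 → ℝ) : dipole :=
  ⟨fun n => inner ℝ (WithLp.toLp 2 v) n.1, _, fun _ => rfl⟩

theorem dipoleOf_surjective : Function.Surjective dipoleOf := by
  rintro ⟨F, v, hv⟩
  exact ⟨v.ofLp, Subtype.ext (funext fun n => (hv n).symm)⟩

/-- The components of `v`, indexed as those of a spatial vector in the chart. -/
def spatial (v : Fin 3 → ℝ) (i : Fin 4) : ℝ := (![0, v 0, v 1, v 2] : Fin 4 → ℝ) i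

theorem dipoleOf_apply (v : Fin 3 → ℝ) (n : S2) :
    (dipoleOf v).1 n = v 0 * n.1 0 + v 1 * n.1 1 + v 2 * n.1 2 := by
  simp [dipoleOf, PiLp.inner_apply, Fin.sum_univ_three, mul_comm]

variable {p : Coord}

theorem angle_apply (h : space p ≠ 0) (a : Fin 3) :
    (angle p).1 a = p a.succ / ‖space p‖ := by
  simp only [angle, h, dite_false]
  fin_cases a <;> simp [space] <;> ring

theorem differentiableAt_angle (h : space p ≠ 0) (a : Fin 3) :
    DifferentiableAt ℝ (fun q => (angle q).1 a) p := by
  have hc : Continuous space := by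
    unfold space
    fun_prop
  have ev : (fun q => (angle q).1 a) =ᶠ[nhds p] fun q => q a.succ * ‖space q‖⁻¹ := by
    filter_upwards [hc.continuousAt.eventually_ne h] with q hq
    rw [angle_apply hq, div_eq_mul_inv]
  refine DifferentiableAt.congr_of_eventuallyEq ?_ ev
  exact (differentiableAt_apply _ _).mul
    ((hasFDerivAt_inv (norm_ne_zero_iff.2 h)).comp p (hasFDerivAt_norm_space p h)).differentiableAt

theorem dipoleOf_angle (v : Fin 3 → ℝ) (h : space p ≠ 0) :
    (dipoleOf v).1 (angle p) = dot v p / ‖space p‖ := by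
  rw [dipoleOf_apply, angle_apply h, angle_apply h, angle_apply h]
  simp only [dot, Fin.succ_zero_eq_one, Fin.succ_one_eq_two, show (Fin.succ 2 : Fin 4) = 3 from rfl]
  ring

theorem dS_dipoleOf (v : Fin 3 → ℝ) (h : space p ≠ 0) (i : Fin 4) :
    dS (dipoleOf v).1 p i = if i = 0 then 0 else
      (spatial v i - dot v p * p i / ‖space p‖ ^ 2) / ‖space p‖ := by
  have d := differentiableAt_angle h
  have d0 := d 0
  have d1 := d 1
  have d2 := d 2
  have : dS (dipoleOf v).1 p i = v 0 * dn p i 0 + v 1 * dn p i 1 + v 2 * dn p i 2 := by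
    unfold dS
    simp only [dipoleOf_apply]
    rw [pd_add (by fun_prop) (by fun_prop), pd_add (by fun_prop) (by fun_prop),
      pd_mul (by fun_prop) (by fun_prop), pd_mul (by fun_prop) (by fun_prop),
      pd_mul (by fun_prop) (by fun_prop), pd_const, pd_const, pd_const]
    simp [dn]
  rw [this, dn_eq p h, dn_eq p h, dn_eq p h]
  fin_cases i <;> simp [spatial, dot] <;> ring

theorem dt_eq (p : Coord) (i : Fin 4) : dt p i = if i = 0 then 1 else 0 :=
  pd_coord 0 p i

theorem eps_eq (p : Coord) (i j : Fin 4) : eps p i j = Real.sin (xCoord p) ^ 2 *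
    ((angle p).1 0 * (dn p i 1 * dn p j 2 - dn p i 2 * dn p j 1)
      + (angle p).1 1 * (dn p i 2 * dn p j 0 - dn p i 0 * dn p j 2)
      + (angle p).1 2 * (dn p i 0 * dn p j 1 - dn p i 1 * dn p j 0)) := by
  rw [eps]
  congr 1
  refine (Matrix.det_fin_three _).trans ?_
  simp
  ring

/-- The rotation form is `-½ D × y` with its index lowered. -/
theorem formR_dipoleOf (D : Fin 3 → ℝ) (h : space p ≠ 0) (i : Fin 4) :
    formR (dipoleOf D).1 p i = -2 / rho p ^ 2 *
      (![0, D 1 * p 3 - D 2 * p 2, D 2 * p 1 - D 0 * p 3, D 0 * p 2 - D 1 * p 1] : Fin 4 → ℝ) i := by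
  have hr : ‖space p‖ ≠ 0 := norm_ne_zero_iff.2 h
  have hρ := rho_ne_zero p
  have hinv : (confMetric p)⁻¹ = Matrix.diagonal fun k => (coef k p)⁻¹ := by
    refine Matrix.inv_eq_right_inv ?_
    have : confMetric p = Matrix.diagonal fun k => coef k p := by
      rw [confMetric]
      congr 1
      ext k
      simp only [coef, invRho, rho_eq, div_eq_mul_inv, inv_pow]
    rw [this, Matrix.diagonal_mul_diagonal, ← Matrix.diagonal_one]
    congr 1
    ext k
    exact mul_inv_cancel₀ (coef_ne_zero k p)
  have hmix : ∀ k, epsMixed p i k = eps p i k * (coef k p)⁻¹ := by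
    intro k
    rw [epsMixed, hinv]
    simp [Matrix.diagonal_apply]
  simp only [formR, hmix, Fin.sum_univ_four, dS_dipoleOf D h, eps_eq, sin_xCoord, dn_eq p h,
    angle_apply h, coef, invRho, spatial, dot]
  generalize rho p = ρ at *
  generalize ‖space p‖ = r at *
  fin_cases i <;> simp <;> field_simp <;> ring

theorem ckv_of_ne_zero (G D J₀ J₁ : Fin 3 → ℝ) (a₀ a₁ c : ℝ) (p : Coord) {i : Fin 4} (hi : i ≠ 0) :
    ckv G D J₀ J₁ a₀ a₁ c i p = 1 / 2 * ((2 - rho p) * (spatial G i + spatial J₁ i)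
      - (![0, D 1 * p 3 - D 2 * p 2, D 2 * p 1 - D 0 * p 3, D 0 * p 2 - D 1 * p 1] : Fin 4 → ℝ) i
      - rho p * (Real.cos (p 0) * spatial J₁ i + Real.sin (p 0) * spatial J₀ i))
      + p i * radial G J₀ J₁ a₀ a₁ p := by
  fin_cases i <;> simp [ckv, spatial] at hi ⊢

/-- The parameters of the explicit solutions: `G, D, J₀, J₁` as vectors of `ℝ³`, and
`a₀, a₁, c`. -/
abbrev Params : Type :=
  (Fin 3 → ℝ) × (Fin 3 → ℝ) × (Fin 3 → ℝ) × (Fin 3 → ℝ) × ℝ × ℝ × ℝ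

/-- The explicit solution with given parameters. -/
noncomputable def Params.field : Params → Fin 4 → Coord → ℝ
  | (G, D, J₀, J₁, a₀, a₁, c) => ckv G D J₀ J₁ a₀ a₁ c

/-- The parameters, with vectors replaced by dipole functions. -/
noncomputable def Params.toData : Params → Data
  | (G, D, J₀, J₁, a₀, a₁, c) => ⟨dipoleOf G, dipoleOf D, dipoleOf J₀, dipoleOf J₁, a₀, a₁, c⟩

theorem Params.toData_surjective : Function.Surjective Params.toData := by
  rintro ⟨G, D, J₀, J₁, a₀, a₁, c⟩
  obtain ⟨G, rfl⟩ := dipoleOf_surjective G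
  obtain ⟨D, rfl⟩ := dipoleOf_surjective D
  obtain ⟨J₀, rfl⟩ := dipoleOf_surjective J₀
  obtain ⟨J₁, rfl⟩ := dipoleOf_surjective J₁
  exact ⟨(G, D, J₀, J₁, a₀, a₁, c), rfl⟩

/-- In the global chart, the sum of the listed forms is the explicit solution with its index
lowered by `confMetric`. -/
theorem Params.form_toData (P : Params) (h : space p ≠ 0) (i : Fin 4) :
    P.toData.form p i = coef i p * P.field i p := by
  obtain ⟨G, D, J₀, J₁, a₀, a₁, c⟩ := P
  have hr : ‖space p‖ ≠ 0 := norm_ne_zero_iff.2 h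
  have hρ := rho_ne_zero p
  have hρr := rho_eq p
  simp only [toData, field, Data.form, formR_dipoleOf D h, formP, formT, formB, formD, formKt,
    formKJ, dipoleOf_angle _ h, dS_dipoleOf _ h, dx_eq p h, dt_eq, sin_xCoord, cos_xCoord, tCoord,
    ← hρr]
  generalize ‖space p‖ = r at *
  by_cases hi : i = 0
  · subst hi
    simp only [if_true, coef, ckv, Matrix.cons_val_zero, invRho]
    field_simp
    ring
  · rw [ckv_of_ne_zero _ _ _ _ _ _ _ _ hi]
    simp only [hi, if_false, coef, invRho, radial]
    have hadd : dot (G + J₁) p = dot G p + dot J₁ p := by simp only [dot, Pi.add_apply]; ring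
    rw [hadd]
    generalize (![0, D 1 * p 3 - D 2 * p 2, D 2 * p 1 - D 0 * p 3, D 0 * p 2 - D 1 * p 1] :
      Fin 4 → ℝ) i = X
    generalize rho p = ρ at *
    subst hρr
    field_simp
    ring

theorem Params.isGivenBy_iff (l : ℝ) (P : Params) (ξ : Coord → Fin 4 → ℝ) :
    IsGivenBy l P.toData ξ ↔
      ∀ p ∈ region, space p ≠ 0 → ∀ i, ξ p i = lower l P.field p i := by
  refine forall₄_congr fun p hp h i => ?_
  rw [P.form_toData h, confFactor_eq, lower, mul_assoc]

/-! ### The space of solutions -/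

theorem Params.isCKV_field (P : Params) : IsCKV P.field :=
  isCKV_ckv _ _ _ _ _ _ _

theorem Params.eq_of_field_eq {P P' : Params}
    (h : ∀ p ∈ region, space p ≠ 0 → ∀ i, P.field i p = P'.field i p) : P = P' := by
  obtain ⟨G, D, J₀, J₁, a₀, a₁, c⟩ := P
  obtain ⟨G', D', J₀', J₁', a₀', a₁', c'⟩ := P'
  have key : ∀ t x y z : ℝ, x ^ 2 + y ^ 2 + z ^ 2 = 1 / 4 → ∀ i,
      ckv G D J₀ J₁ a₀ a₁ c i ![t, x, y, z] = ckv G' D' J₀' J₁' a₀' a₁' c' i ![t, x, y, z] := by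
    intro t x y z hs i
    refine h _ ?_ ?_ i
    · rw [mem_region_iff]
      simp [hs]
      norm_num
    · rw [← norm_ne_zero_iff, ← pow_ne_zero_iff two_ne_zero, norm_space_sq]
      simp [hs]
  -- The time component at `|y| = 1 / 2` and `t = 0, π, π / 2` yields `a₀, a₁, c, J₀, J₁`.
  have ha₀ : a₀ = a₀' := by
    have e1 := key 0 (1 / 2) 0 0 (by norm_num) 0
    have e2 := key 0 (-(1 / 2)) 0 0 (by norm_num) 0
    have e3 := key Real.pi (1 / 2) 0 0 (by norm_num) 0
    have e4 := key Real.pi (-(1 / 2)) 0 0 (by norm_num) 0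
    simp [ckv, rho, dot, invRho] at e1 e2 e3 e4
    norm_num at e1 e2 e3 e4
    linarith
  subst ha₀
  have hc : c = c' := by
    have e1 := key 0 (1 / 2) 0 0 (by norm_num) 0
    have e2 := key 0 (-(1 / 2)) 0 0 (by norm_num) 0
    simp [ckv, rho, dot, invRho] at e1 e2
    norm_num at e1 e2
    linarith
  subst hc
  have ha₁ : a₁ = a₁' := by
    have e1 := key (Real.pi / 2) (1 / 2) 0 0 (by norm_num) 0
    have e2 := key (Real.pi / 2) (-(1 / 2)) 0 0 (by norm_num) 0
    simp [ckv, rho, dot, invRho] at e1 e2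
    norm_num at e1 e2
    linarith
  subst ha₁
  have hJ₀ : J₀ = J₀' := by
    have e1 := key 0 (1 / 2) 0 0 (by norm_num) 0
    have e2 := key 0 0 (1 / 2) 0 (by norm_num) 0
    have e3 := key 0 0 0 (1 / 2) (by norm_num) 0
    simp [ckv, rho, dot, invRho] at e1 e2 e3
    norm_num at e1 e2 e3
    ext a
    fin_cases a <;> simp <;> linarith
  subst hJ₀
  have hJ₁ : J₁ = J₁' := by
    have e1 := key (Real.pi / 2) (1 / 2) 0 0 (by norm_num) 0
    have e2 := key (Real.pi / 2) 0 (1 / 2) 0 (by norm_num) 0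
    have e3 := key (Real.pi / 2) 0 0 (1 / 2) (by norm_num) 0
    simp [ckv, rho, dot, invRho] at e1 e2 e3
    norm_num at e1 e2 e3
    ext a
    fin_cases a <;> simp <;> linarith
  subst hJ₁
  -- At `t = 0`, the component of the spatial part along `y` yields `G`, and the orthogonal ones
  -- yield `D`.
  have hG : G = G' := by
    have e1 := key 0 (1 / 2) 0 0 (by norm_num) 1
    have e2 := key 0 0 (1 / 2) 0 (by norm_num) 2
    have e3 := key 0 0 0 (1 / 2) (by norm_num) 3
    simp [ckv, rho, dot, radial] at e1 e2 e3
    norm_num at e1 e2 e3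
    ext a
    fin_cases a <;> simp <;> linarith
  subst hG
  have hD : D = D' := by
    have e1 := key 0 0 (1 / 2) 0 (by norm_num) 3
    have e2 := key 0 0 0 (1 / 2) (by norm_num) 1
    have e3 := key 0 (1 / 2) 0 0 (by norm_num) 2
    simp [ckv, rho, dot, radial] at e1 e2 e3
    ext a
    fin_cases a <;> simp <;> linarith
  subst hD
  rfl

theorem Params.field_add (P P' : Params) (i : Fin 4) (p : Coord) :
    (P + P').field i p = P.field i p + P'.field i p := by
  obtain ⟨G, D, J₀, J₁, a₀, a₁, c⟩ := P
  obtain ⟨G', D', J₀', J₁', a₀', a₁', c'⟩ := P'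
  fin_cases i <;> simp [field, ckv, radial, dot] <;> ring

theorem Params.field_smul (s : ℝ) (P : Params) (i : Fin 4) (p : Coord) :
    (s • P).field i p = s * P.field i p := by
  obtain ⟨G, D, J₀, J₁, a₀, a₁, c⟩ := P
  fin_cases i <;> simp [field, ckv, radial, dot] <;> ring

/-- The linear map from parameters to one-forms on anti-de Sitter space. -/
noncomputable def formMap (l : ℝ) : Params →ₗ[ℝ] region → Fin 4 → ℝ where
  toFun P p := lower l P.field p
  map_add' P P' := by
    ext p i
    simp only [lower, Params.field_add, Pi.add_apply, mul_add]
  map_smul' s P := by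
    ext p i
    simp only [lower, Params.field_smul, Pi.smul_apply, smul_eq_mul, RingHom.id_apply]
    ring

theorem lower_inj {l : ℝ} (hl : l ≠ 0) {V W : Fin 4 → Coord → ℝ} {p : Coord} (hp : p ∈ region)
    {i : Fin 4} (h : lower l V p i = lower l W p i) : V i p = W i p :=
  mul_left_cancel₀ (mul_ne_zero (factor_pos hl hp).ne' (coef_ne_zero i p)) h

theorem formMap_injective {l : ℝ} (hl : l ≠ 0) : Function.Injective (formMap l) :=
  fun _ _ h => Params.eq_of_field_eq fun p hp _ i =>
    lower_inj hl hp (congrFun (congrFun h ⟨p, hp⟩) i)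

/-- Every conformal Killing one-form is one of the explicit solutions with its index lowered. -/
theorem exists_eq_lower_field {l : ℝ} (hl : l ≠ 0) {ξ : Coord → Fin 4 → ℝ}
    (h : IsConformalKilling region (adsMetric l) ξ) :
    ∃ P : Params, ∀ p ∈ region, ∀ i, ξ p i = lower l P.field p i := by
  obtain ⟨V, hV, hξ⟩ := exists_isCKV hl h
  obtain ⟨G, D, J₀, J₁, a₀, a₁, c, e⟩ := hV.exists_eq_ckv
  refine ⟨(G, D, J₀, J₁, a₀, a₁, c), fun p hp i => ?_⟩
  rw [hξ p hp, lower, lower, e p hp]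
  rfl

theorem range_formMap {l : ℝ} (hl : l ≠ 0) :
    LinearMap.range (formMap l) = conformalKillingForms region isOpen_region (adsMetric l) := by
  ext f
  constructor
  · rintro ⟨P, rfl⟩
    exact ⟨_, isConformalKilling_of_isCKV hl P.isCKV_field, fun _ => rfl⟩
  · rintro ⟨ξ, hξ, hf⟩
    obtain ⟨P, hP⟩ := exists_eq_lower_field hl hξ
    refine ⟨P, funext fun p => ?_⟩
    rw [← hf]
    exact funext fun i => (hP p p.2 i).symm

theorem finrank_conformalKillingForms {l : ℝ} (hl : l ≠ 0) : Module.finrank ℝ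
    (conformalKillingForms region isOpen_region (adsMetric l)) = 15 := by
  rw [← range_formMap hl, LinearMap.finrank_range_of_inj (formMap_injective hl)]
  simp [Module.finrank_prod]

end AdS4

theorem mainTheorem6 (l : ℝ) (hl : l ≠ 0) :
    (∀ d : AdS4.Data, ∃ ξ : AdS4.Coord → Fin 4 → ℝ,
      AdS4.IsConformalKilling AdS4.region (AdS4.adsMetric l) ξ ∧ AdS4.IsGivenBy l d ξ) ∧
    (∀ ξ : AdS4.Coord → Fin 4 → ℝ,
      AdS4.IsConformalKilling AdS4.region (AdS4.adsMetric l) ξ →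
        ∃! d : AdS4.Data, AdS4.IsGivenBy l d ξ) ∧
    Module.finrank ℝ
      (AdS4.conformalKillingForms AdS4.region AdS4.isOpen_region (AdS4.adsMetric l)) = 15 := by
  refine ⟨fun d => ?_, fun ξ hξ => ?_, AdS4.finrank_conformalKillingForms hl⟩
  · obtain ⟨P, rfl⟩ := AdS4.Params.toData_surjective d
    exact ⟨_, AdS4.isConformalKilling_of_isCKV hl P.isCKV_field,
      (P.isGivenBy_iff l _).2 fun _ _ _ _ => rfl⟩
  · obtain ⟨P, hP⟩ := AdS4.exists_eq_lower_field hl hξ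
    refine ⟨P.toData, (P.isGivenBy_iff l _).2 fun p hp _ i => hP p hp i, fun d hd => ?_⟩
    obtain ⟨P', rfl⟩ := AdS4.Params.toData_surjective d
    rw [P'.isGivenBy_iff l] at hd
    refine congrArg _ (AdS4.Params.eq_of_field_eq fun p hp h i => AdS4.lower_inj hl hp ?_)
    rw [← hd p hp h, hP p hp]
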